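/- Let $\Bbbk$ be a field, let $(a_{ij})_{i,j\in I}$ be a Coxeter matrix with finite index set $I$ (entries $a_{ij}=\infty$ allowed for $i\ne j$), with Coxeter group $W$, and let $\mathbf d=(d_i)_{i\in I}$ be integers with $d_i\ge 2$. Let $A=NC_W(\mathbf d)$ be the generalized nil-Coxeter algebra: the unital associative $\Bbbk$-algebra generated by $T_i$, $i\in I$, subject to the braid relations $T_iT_jT_i\cdots=T_jT_iT_j\cdots$ ($a_{ij}$ factors on each side, for $i\neq j$ with $a_{ij}<\infty$) and $T_i^{d_i}=0$ for all $i$. It carries the coassociative, cocommutative, multiplicative coproduct $\Delta:A\to A\otimes A$, $\Delta(a)=\sum a_{(1)}\otimes a_{(2)}$, determined by $\Delta(T_i)=T_i\otimes T_i$. Let $V$ be an $A$-module, of possibly infinite dimension over $\Bbbk$. For $\Bbbk$-linear maps $\lambda:V\otimes A\to A$ and $\kappa:\wedge^2V\to V\oplus A$, with components $\kappa_V:\wedge^2V\to V$ and $\kappa_A:\wedge^2V\to A$, let $\mathscr H_{\lambda,\kappa}$ be the quotient of the tensor algebra $T(V\oplus A)$ by the unit and the multiplication of $A$ and by the relations $$a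 v-\sum a_{(1)}(v)\,a_{(2)}=\lambda(a,v),\qquad v v'-v'v=\kappa(v,v')\qquad(a\in A,\ v,v'\in V).$$ One says that $\mathscr H_{\lambda,\kappa}$ has the PBW property if for every totally ordered $\Bbbk$-basis $(x_i)$ of $V$ and every $\Bbbk$-basis $(a_j)$ of $A$, the elements $X\cdot a_j$, where $X$ runs over the words in the $x_i$ with non-decreasing subscripts (including the empty word), form a $\Bbbk$-basis of $\mathscr H_{\lambda,\kappa}$. For an $A$-module $N$ put $\operatorname{Prim}(N)=\{n\in N: T_in=0\ \text{for all } i\in I\}$, and regard $A$ as a module over itself by left multiplication. Suppose that the two-sided ideal $\mathfrak m$ of $A$ generated by $\{T_i:i\in I\}$ is nilpotent. (1) If $\dim_\Bbbk V\le 2$, then $\mathscr H_{0,\kappa}$ has the PBW property if and only if $\operatorname{im}\kappa_V\subset\operatorname{Prim}(V)$ and $\operatorname{im}\kappa_A\subset\operatorname{Prim}(A)$. (2) If $I\neq\emptyset$, $\dim_\Bbbk V>2$, $\lambda=0$ and $\kappa_V=0$, then $\mathscr H_{0,\kappa_A}$ has the PBW property if and only if $\kappa_A=0$. -/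

import Mathlib

open scoped TensorProduct

universe u v w

noncomputable section

/-! ### Algebras with a cocommutative coproduct -/

/-- A multiplicative, coassociative and cocommutative coproduct on a unital `k`-algebra `A`
(no counit is required; `Δ 1 = 1 ⊗ 1` since `Δ` is a map of unital algebras). -/
structure CocommCoproduct (k : Type u) (A : Type w) [CommRing k] [Ring A] [Algebra k A] where
  /-- The coproduct `Δ`. -/
  comul : A →ₐ[k] A ⊗[k] A
  coassoc :
    ((Algebra.TensorProduct.assoc k k k A A A).toAlgHom.comp
      (Algebra.TensorProduct.map comul (AlgHom.id k A))).comp comul =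
    (Algebra.TensorProduct.map (AlgHom.id k A) comul).comp comul
  cocomm : (Algebra.TensorProduct.comm k A A).toAlgHom.comp comul = comul

/-! ### Deformed smash product algebras -/

namespace DeformedSmash

section

variable (k : Type u) [CommRing k] {A : Type w} [Ring A] [Algebra k A]
  {V : Type v} [AddCommGroup V] [Module k V] [Module A V] [IsScalarTower k A V]

/-- The inclusion of `V` in `T(V ⊕ A)`. -/
def tV (A : Type w) [Ring A] [Algebra k A] (V : Type v) [AddCommGroup V] [Module k V] :
    V →ₗ[k] TensorAlgebra k (V × A) :=
  TensorAlgebra.ι k ∘ₗ LinearMap.inl k V A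

/-- The inclusion of `A` in `T(V ⊕ A)` (only a linear map). -/
def tA (A : Type w) [Ring A] [Algebra k A] (V : Type v) [AddCommGroup V] [Module k V] :
    A →ₗ[k] TensorAlgebra k (V × A) :=
  TensorAlgebra.ι k ∘ₗ LinearMap.inr k V A

/-- For `v` in `V`, the linear map `A ⊗ A → T(V ⊕ A)`, `a₁ ⊗ a₂ ↦ a₁(v) · a₂`. Its value at `Δ a`
is `∑ a₍₁₎(v) a₍₂₎`. -/
def cross (x : V) : A ⊗[k] A →ₗ[k] TensorAlgebra k (V × A) :=
  TensorProduct.lift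
    ((LinearMap.mul k (TensorAlgebra k (V × A))).compl₁₂
      (tV k A V ∘ₗ (LinearMap.toSpanSingleton A V x).restrictScalars k) (tA k A V))

variable {k}

/-- The component `κ_V` of `κ : ∧² V → V ⊕ A`. -/
def kappaV (κ : ⋀[k]^2 V →ₗ[k] V × A) : ⋀[k]^2 V →ₗ[k] V := LinearMap.fst k V A ∘ₗ κ

/-- The component `κ_A` of `κ : ∧² V → V ⊕ A`. -/
def kappaA (κ : ⋀[k]^2 V →ₗ[k] V × A) : ⋀[k]^2 V →ₗ[k] A := LinearMap.snd k V A ∘ₗ κ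

/-- The defining relations of `H_{λ,κ}(A,V)` as a quotient of `T(V ⊕ A)`: the unit and the
multiplication of `A`, the relation `a v - ∑ a₍₁₎(v) a₍₂₎ = λ(a,v)`, and
`v v' - v' v = κ(v,v')`. -/
inductive Rel (Δ : CocommCoproduct k A) (lam : V ⊗[k] A →ₗ[k] A)
    (κ : ⋀[k]^2 V →ₗ[k] V × A) :
    TensorAlgebra k (V × A) → TensorAlgebra k (V × A) → Prop
  | one : Rel Δ lam κ (tA k A V 1) 1
  | mul (a a' : A) : Rel Δ lam κ (tA k A V a * tA k A V a') (tA k A V (a * a'))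
  | act (a : A) (x : V) :
      Rel Δ lam κ (tA k A V a * tV k A V x - cross k x (Δ.comul a)) (tA k A V (lam (x ⊗ₜ a)))
  | comm (x y : V) :
      Rel Δ lam κ (tV k A V x * tV k A V y - tV k A V y * tV k A V x)
        (TensorAlgebra.ι k (κ (exteriorPower.ιMulti k 2 ![x, y])))

end

end DeformedSmash

section

variable {k : Type u} [CommRing k] {A : Type w} [Ring A] [Algebra k A]
  {V : Type v} [AddCommGroup V] [Module k V] [Module A V] [IsScalarTower k A V]

/-- The deformed smash product algebra `H_{λ,κ}(A,V)`. -/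
def DeformedSmash (Δ : CocommCoproduct k A) (lam : V ⊗[k] A →ₗ[k] A)
    (κ : ⋀[k]^2 V →ₗ[k] V × A) : Type (max u v w) :=
  RingQuot (DeformedSmash.Rel Δ lam κ)

namespace DeformedSmash

variable (Δ : CocommCoproduct k A) (lam : V ⊗[k] A →ₗ[k] A) (κ : ⋀[k]^2 V →ₗ[k] V × A)

instance : Ring (DeformedSmash Δ lam κ) := inferInstanceAs (Ring (RingQuot _))

instance : Algebra k (DeformedSmash Δ lam κ) := inferInstanceAs (Algebra k (RingQuot _))

/-- The quotient map `T(V ⊕ A) → H_{λ,κ}`. -/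
def mk : TensorAlgebra k (V × A) →ₐ[k] DeformedSmash Δ lam κ :=
  RingQuot.mkAlgHom k (Rel Δ lam κ)

/-- The natural map `V → H_{λ,κ}`. -/
def ofV : V →ₗ[k] DeformedSmash Δ lam κ := (mk Δ lam κ).toLinearMap ∘ₗ tV k A V

/-- The natural map `A → H_{λ,κ}`. -/
def ofA : A →ₗ[k] DeformedSmash Δ lam κ := (mk Δ lam κ).toLinearMap ∘ₗ tA k A V

/-- For a totally ordered basis `b` of `V` and a basis `c` of `A`, the family of elements `X · a`
of `H_{λ,κ}`, where `X` is a word in the `b i` with non-decreasing subscripts and `a` is one of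
the `c j`. -/
def pbwMonomial {ι : Type v} [LinearOrder ι] {J : Type w} (b : Module.Basis ι k V)
    (c : Module.Basis J k A) (p : {l : List ι // l.Pairwise (· ≤ ·)} × J) :
    DeformedSmash Δ lam κ :=
  ((p.1 : List ι).map fun i => ofV Δ lam κ (b i)).prod * ofA Δ lam κ (c p.2)

/-- The PBW property of `H_{λ,κ}`: for every totally ordered `k`-basis of `V` and every `k`-basis
of `A`, the PBW monomials form a `k`-basis of `H_{λ,κ}`. -/
def HasPBW : Prop :=
  ∀ (ι : Type v) [LinearOrder ι] (J : Type w) (b : Module.Basis ι k V) (c : Module.Basis J k A),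
    LinearIndependent k (pbwMonomial Δ lam κ b c) ∧
      Submodule.span k (Set.range (pbwMonomial Δ lam κ b c)) = ⊤

end DeformedSmash

end

/-! ### Generalized nil-Coxeter algebras -/

section

variable (k : Type u) [CommRing k] {I : Type w} (M : CoxeterMatrix I) (d : I → ℕ)

/-- The relations of `NC_W(d)` on the free algebra on `T_i`, `i ∈ I`: the braid relations, with
`M i j` alternating factors on either side (no relation if `M i j = 0`, which is Mathlib's encoding
of the Coxeter matrix entry `∞`), and `T_i ^ d_i = 0`. -/
inductive NilCoxeter.Rel : FreeAlgebra k I → FreeAlgebra k I → Prop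
  | braid (i j : I) (h : i ≠ j) :
      NilCoxeter.Rel
        ((CoxeterSystem.alternatingWord i j (M i j)).map (FreeAlgebra.ι k)).prod
        ((CoxeterSystem.alternatingWord j i (M i j)).map (FreeAlgebra.ι k)).prod
  | nil (i : I) : NilCoxeter.Rel (FreeAlgebra.ι k i ^ d i) 0

/-- The generalized nil-Coxeter algebra `NC_W(d)` over `k` of the Coxeter matrix `M`. -/
def NilCoxeter : Type (max u w) := RingQuot (NilCoxeter.Rel k M d)

namespace NilCoxeter

instance : Ring (NilCoxeter k M d) := inferInstanceAs (Ring (RingQuot _))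

instance : Algebra k (NilCoxeter k M d) := inferInstanceAs (Algebra k (RingQuot _))

/-- The quotient map from the free algebra. -/
def mk : FreeAlgebra k I →ₐ[k] NilCoxeter k M d := RingQuot.mkAlgHom k (Rel k M d)

/-- The generator `T_i`. -/
def T (i : I) : NilCoxeter k M d := mk k M d (FreeAlgebra.ι k i)

lemma mk_rel {x y : FreeAlgebra k I} (h : Rel k M d x y) : mk k M d x = mk k M d y :=
  RingQuot.mkAlgHom_rel k h

@[ext]
lemma algHom_ext {B : Type*} [Semiring B] [Algebra k B] {f g : NilCoxeter k M d →ₐ[k] B}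
    (h : ∀ i, f (T k M d i) = g (T k M d i)) : f = g :=
  RingQuot.ringQuot_ext' k f g (FreeAlgebra.hom_ext (funext h))

/-- The map `T_i ↦ T_i ⊗ T_i` on the free algebra. -/
def freeComul : FreeAlgebra k I →ₐ[k] NilCoxeter k M d ⊗[k] NilCoxeter k M d :=
  FreeAlgebra.lift k fun i => T k M d i ⊗ₜ T k M d i

lemma freeComul_word (l : List I) :
    freeComul k M d (l.map (FreeAlgebra.ι k)).prod =
      mk k M d (l.map (FreeAlgebra.ι k)).prod ⊗ₜ mk k M d (l.map (FreeAlgebra.ι k)).prod := by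
  induction l with
  | nil => simp [Algebra.TensorProduct.one_def]
  | cons i l ih =>
    simp only [List.map_cons, List.prod_cons, map_mul, ih]
    simp [freeComul, T, Algebra.TensorProduct.tmul_mul_tmul]

lemma freeComul_rel ⦃x y : FreeAlgebra k I⦄ (h : Rel k M d x y) :
    freeComul k M d x = freeComul k M d y := by
  have e := mk_rel k M d h
  cases h with
  | braid i j h => rw [freeComul_word, freeComul_word, e]
  | nil i =>
    have h1 : (FreeAlgebra.ι k i : FreeAlgebra k I) ^ d i =
        ((List.replicate (d i) i).map (FreeAlgebra.ι k)).prod := by simp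
    rw [h1] at e ⊢
    rw [freeComul_word, e]
    simp

/-- The coproduct of `NC_W(d)`, determined by `Δ(T_i) = T_i ⊗ T_i` and multiplicativity. -/
def comul : NilCoxeter k M d →ₐ[k] NilCoxeter k M d ⊗[k] NilCoxeter k M d :=
  RingQuot.liftAlgHom k ⟨freeComul k M d, freeComul_rel k M d⟩

@[simp]
lemma comul_T (i : I) : comul k M d (T k M d i) = T k M d i ⊗ₜ T k M d i := by
  have h : comul k M d (mk k M d (FreeAlgebra.ι k i)) = freeComul k M d (FreeAlgebra.ι k i) :=
    RingQuot.liftAlgHom_mkAlgHom_apply k _ _ _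
  rw [T, h]
  simp [freeComul, T]

/-- `NC_W(d)` as a cocommutative algebra. -/
def coproduct : CocommCoproduct k (NilCoxeter k M d) where
  comul := comul k M d
  coassoc := by
    ext i
    simp
  cocomm := by
    ext i
    simp

/-- The two-sided ideal `𝔪` of `NC_W(d)` generated by the `T_i`. -/
def maxIdeal : TwoSidedIdeal (NilCoxeter k M d) :=
  TwoSidedIdeal.span (Set.range (T k M d))

/-- `Prim(N)`: the elements of an `NC_W(d)`-module `N` that are killed by all `T_i`. -/
def Prim (N : Type v) [AddCommGroup N] [Module k N] [Module (NilCoxeter k M d) N]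
    [IsScalarTower k (NilCoxeter k M d) N] : Submodule k N where
  carrier := {n | ∀ i, T k M d i • n = 0}
  add_mem' := fun {a b} ha hb i => by rw [smul_add, ha i, hb i, add_zero]
  zero_mem' := fun i => smul_zero _
  smul_mem' := fun c n hn i => by
    rw [← algebraMap_smul (NilCoxeter k M d) c n, ← mul_smul, ← Algebra.commutes, mul_smul, hn i,
      smul_zero]

end NilCoxeter

end

end

/-!
The algebra `A = NC_W(d)` is spanned by the words in the `T_i`, and words are grouplike, so that
with `λ = 0` the relations of `H_{0,κ}` need only be considered for the generators:
`T_i v = T_i(v) T_i`.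

Straightening shows that the PBW monomials always span `H_{0,κ}`, and that those with at most `n`
letters span the `n`-th step `(k + V)ⁿ A` of a filtration
(`DeformedSmash.span_pbwMonomial_eq_filt`).
What is at stake is their linear independence.

*Necessity.* Under the PBW property `V ⊗ A ⊕ A` embeds into `H_{0,κ}`. Comparing both sides of
`T_i [x, y] = [T_i x, T_i y] T_i` there gives the compatibility of `κ` with the action
(`NilCoxeter.compat_of_hasPBW`). If `dim V ≤ 2`, then `T_i`, being nilpotent on `V`, kills `∧² V`,
and compatibility says that the values of `κ_V` and `κ_A` are primitive. If `dim V > 2` and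
`κ_V = 0`, the Jacobi identity says that `∑ z ⊗ κ_A(x, y)`, summed over the cyclic permutations of
`x, y, z`, is a fixed point of `v ⊗ T_w ↦ T_w v ⊗ T_w`. This map is nilpotent on `V ⊗ 𝔪` and is the
identity on `V ⊗ 1`, so `κ_A` has scalar values; compatibility then gives
`κ_A(x, y) = κ_A(T_i x, T_i y) = ⋯ = κ_A(T_i ^ d_i x, T_i ^ d_i y) = 0`.

*Sufficiency.* An action of `H_{0,κ}` on `S(V) ⊗ A` is constructed in which the PBW monomials,
applied to `1 ⊗ 1`, give the monomial basis. For `κ = 0` the generators `T_i` act diagonally and `V`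
acts by multiplication. There remains the case `dim V = 2`. As `𝔪` is nilpotent, `V` has a basis
`e, f` with `T_i e = 0` and `T_i f ∈ k e`. Then the diagonal action of `A` and the multiplication by
`e` may be kept as they are, while the action of `f` on `eᵐ g` is defined by recursion on `m` so
that `[e, f] = κ(e, f)` holds (`NilCoxeter.deformedOp`); primitivity of `κ(e, f)` makes this
compatible with the `T_i`. The result for this basis carries over to an arbitrary basis of `V` by a
dimension count in each step of the filtration, `A` being finite-dimensional.
-/

/-! ### Words in nil-Coxeter algebras -/

namespace NilCoxeter

section

variable (k : Type u) [CommRing k] {I : Type w} (M : CoxeterMatrix I) (d : I → ℕ)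

/-- The monomial `T_{i₁} ⋯ T_{iₙ}` of a word `[i₁, …, iₙ]`. -/
noncomputable def word (l : List I) : NilCoxeter k M d := (l.map (T k M d)).prod

@[simp]
lemma word_nil : word k M d [] = 1 := rfl

lemma word_cons (i : I) (l : List I) : word k M d (i :: l) = T k M d i * word k M d l := by
  simp [word]

lemma word_append (l l' : List I) :
    word k M d (l ++ l') = word k M d l * word k M d l' := by
  simp [word]

lemma span_range_word : Submodule.span k (Set.range (word k M d)) = ⊤ := by
  refine (eq_top_iff).2 fun a ha => ?_
  obtain ⟨x, rfl⟩ := RingQuot.mkAlgHom_surjective k (Rel k M d) a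
  clear ha
  change mk k M d x ∈ _
  induction x with
  | grade0 r =>
    rw [AlgHom.commutes, Algebra.algebraMap_eq_smul_one]
    exact Submodule.smul_mem _ _ (Submodule.subset_span ⟨[], rfl⟩)
  | grade1 i => exact Submodule.subset_span ⟨[i], by simp [word, T]⟩
  | mul x y hx hy =>
    rw [map_mul]
    have h := Submodule.mul_mem_mul hx hy
    rw [Submodule.span_mul_span] at h
    refine Submodule.span_mono ?_ h
    rintro _ ⟨_, ⟨l, rfl⟩, _, ⟨l', rfl⟩, rfl⟩
    exact ⟨l ++ l', word_append k M d l l'⟩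
  | add x y hx hy =>
    rw [map_add]
    exact Submodule.add_mem _ hx hy

variable {k M d} in
/-- Linear maps out of `NC_W(d)` are determined by their values on words. -/
lemma linearMap_ext_word {N : Type*} [AddCommGroup N] [Module k N]
    {f g : NilCoxeter k M d →ₗ[k] N} (h : ∀ l, f (word k M d l) = g (word k M d l)) : f = g :=
  LinearMap.ext_on_range (span_range_word k M d) h

/-- Words are grouplike. -/
lemma comul_word (l : List I) :
    (coproduct k M d).comul (word k M d l) = word k M d l ⊗ₜ word k M d l := by
  induction l with
  | nil => simp [Algebra.TensorProduct.one_def]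
  | cons i l ih =>
    rw [word_cons, map_mul, ih]
    change comul k M d (T k M d i) * _ = _
    rw [comul_T, Algebra.TensorProduct.tmul_mul_tmul]

lemma T_pow (i : I) : T k M d i ^ d i = 0 := by
  have := mk_rel k M d (Rel.nil i)
  rwa [map_pow, map_zero] at this

lemma word_alternatingWord {i j : I} (h : i ≠ j) :
    word k M d (CoxeterSystem.alternatingWord i j (M i j)) =
      word k M d (CoxeterSystem.alternatingWord j i (M i j)) := by
  have e := mk_rel k M d (Rel.braid i j h)
  rwa [map_list_prod, map_list_prod, List.map_map, List.map_map] at e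

variable {k M d} in
/-- The universal property of `NC_W(d)`. -/
noncomputable def lift {B : Type*} [Semiring B] [Algebra k B] (f : I → B)
    (hb : ∀ i j, i ≠ j → ((CoxeterSystem.alternatingWord i j (M i j)).map f).prod =
      ((CoxeterSystem.alternatingWord j i (M i j)).map f).prod)
    (hn : ∀ i, f i ^ d i = 0) : NilCoxeter k M d →ₐ[k] B :=
  RingQuot.liftAlgHom k ⟨FreeAlgebra.lift k f, fun x y h => by
    cases h with
    | braid i j h => simpa [map_list_prod, Function.comp_def] using hb i j h
    | nil i => simpa using hn i⟩

@[simp]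
lemma lift_T {B : Type*} [Semiring B] [Algebra k B] (f : I → B) (hb) (hn) (i : I) :
    lift (k := k) (M := M) (d := d) f hb hn (T k M d i) = f i := by
  have h : lift (k := k) (M := M) (d := d) f hb hn (mk k M d (FreeAlgebra.ι k i)) =
      FreeAlgebra.lift k f (FreeAlgebra.ι k i) :=
    RingQuot.liftAlgHom_mkAlgHom_apply k _ _ _
  rw [T, h, FreeAlgebra.lift_ι_apply]

variable {k M d} in
lemma algHom_word {B : Type*} [Semiring B] [Algebra k B] (ρ : NilCoxeter k M d →ₐ[k] B)
    (l : List I) : ρ (word k M d l) = (l.map fun i => ρ (T k M d i)).prod := by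
  simp [word, map_list_prod, Function.comp_def]

variable {d} in
/-- All generators may be sent to `ε` in the dual numbers, so they do not vanish. -/
lemma T_ne_zero [Nontrivial k] (hd : ∀ i, 2 ≤ d i) (i : I) : T k M d i ≠ 0 := by
  intro h
  have e : (DualNumber.eps : DualNumber k) ^ 2 = 0 := by simp [pow_two]
  let φ : NilCoxeter k M d →ₐ[k] DualNumber k := lift (fun _ => DualNumber.eps)
    (fun i j _ => by simp) (fun i => pow_eq_zero_of_le (hd i) e)
  have h2 : φ (T k M d i) = DualNumber.eps := lift_T k M d _ _ _ i
  rw [h, map_zero] at h2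
  have := congrArg TrivSqZeroExt.snd h2
  simp at this

lemma word_mem_maxIdeal_pow (l : List I) :
    word k M d l ∈ (maxIdeal k M d).asIdeal ^ l.length := by
  induction l using List.reverseRecOn with
  | nil =>
    rw [List.length_nil, Submodule.pow_zero, Ideal.one_eq_top]
    trivial
  | append_singleton l i ih =>
    rw [word_append, List.length_append, List.length_singleton, Submodule.pow_succ]
    refine Ideal.mul_mem_mul ih (TwoSidedIdeal.mem_asIdeal.2 (TwoSidedIdeal.subset_span ⟨i, ?_⟩))
    simp [word]

variable {k M d} in
lemma word_eq_zero {n : ℕ} (hn : (maxIdeal k M d).asIdeal ^ n = ⊥) {l : List I}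
    (hl : n ≤ l.length) : word k M d l = 0 := by
  have h := Ideal.pow_le_pow_right hl (word_mem_maxIdeal_pow k M d l)
  rwa [hn] at h

lemma word_pow (l : List I) (n : ℕ) :
    word k M d l ^ n = word k M d (List.replicate n l).flatten := by
  induction n with
  | zero => simp
  | succ n ih => rw [pow_succ', ih, List.replicate_succ, List.flatten_cons, word_append]

variable {k M d} in
lemma word_pow_eq_zero {n : ℕ} (hn : (maxIdeal k M d).asIdeal ^ n = ⊥) {l : List I}
    (hl : l ≠ []) : word k M d l ^ n = 0 := by
  rw [word_pow]
  refine word_eq_zero hn ?_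
  have := List.length_pos_iff.2 hl
  simpa using Nat.le_mul_of_pos_right n this

variable {k M d} in
lemma finite_of_maxIdeal_pow [Finite I] {n : ℕ} (hn : (maxIdeal k M d).asIdeal ^ n = ⊥) :
    Module.Finite k (NilCoxeter k M d) := by
  have hf : {l : List I | l.length < n}.Finite := List.finite_length_lt I n
  have : Submodule.span k (word k M d '' {l : List I | l.length < n}) = ⊤ := by
    rw [eq_top_iff, ← span_range_word, Submodule.span_le]
    rintro _ ⟨l, rfl⟩
    by_cases h : l.length < n
    · exact Submodule.subset_span ⟨l, h, rfl⟩
    · rw [SetLike.mem_coe, word_eq_zero hn (not_lt.1 h)]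
      exact zero_mem _
  exact ⟨this ▸ Submodule.fg_span (hf.image _)⟩

end

end NilCoxeter

/-! ### The relations and the universal property of `H_{λ,κ}` -/

namespace DeformedSmash

section

variable {k : Type u} [CommRing k] {A : Type w} [Ring A] [Algebra k A]
  {V : Type v} [AddCommGroup V] [Module k V] [Module A V] [IsScalarTower k A V]
  (Δ : CocommCoproduct k A) (lam : V ⊗[k] A →ₗ[k] A) (κ : ⋀[k]^2 V →ₗ[k] V × A)

lemma mk_rel {x y : TensorAlgebra k (V × A)} (h : Rel Δ lam κ x y) :
    mk Δ lam κ x = mk Δ lam κ y :=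
  RingQuot.mkAlgHom_rel k h

lemma mk_ι (x : V × A) : mk Δ lam κ (TensorAlgebra.ι k x) = ofV Δ lam κ x.1 + ofA Δ lam κ x.2 := by
  rw [ofV, ofA, LinearMap.comp_apply, LinearMap.comp_apply, ← map_add, tV, tA,
    LinearMap.comp_apply, LinearMap.comp_apply, ← map_add]
  simp

@[simp]
lemma ofA_one : ofA Δ lam κ 1 = 1 := by
  have := mk_rel Δ lam κ Rel.one
  exact this.trans (map_one _)

lemma ofA_mul (a a' : A) : ofA Δ lam κ (a * a') = ofA Δ lam κ a * ofA Δ lam κ a' := by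
  have := mk_rel Δ lam κ (Rel.mul a a')
  rw [map_mul] at this
  exact this.symm

lemma ofV_mul_sub (x y : V) :
    ofV Δ lam κ x * ofV Δ lam κ y - ofV Δ lam κ y * ofV Δ lam κ x =
      ofV Δ lam κ (kappaV κ (exteriorPower.ιMulti k 2 ![x, y])) +
        ofA Δ lam κ (kappaA κ (exteriorPower.ιMulti k 2 ![x, y])) := by
  have := mk_rel Δ lam κ (Rel.comm x y)
  rw [map_sub, map_mul, map_mul, mk_ι] at this
  exact this

/-- The multiplication `V ⊗ A → H_{λ,κ}`, `v ⊗ a ↦ v a`. -/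
noncomputable def mulVA : V ⊗[k] A →ₗ[k] DeformedSmash Δ lam κ :=
  TensorProduct.lift ((LinearMap.mul k (DeformedSmash Δ lam κ)).compl₁₂
    (ofV Δ lam κ) (ofA Δ lam κ))

@[simp]
lemma mulVA_tmul (x : V) (a : A) : mulVA Δ lam κ (x ⊗ₜ a) = ofV Δ lam κ x * ofA Δ lam κ a := rfl

variable (k A) in
/-- The linear map `A → V`, `a ↦ a v`. -/
noncomputable def orbit (x : V) : A →ₗ[k] V := (LinearMap.toSpanSingleton A V x).restrictScalars k

variable (k A) in
@[simp]
lemma orbit_apply (x : V) (a : A) : orbit k A x a = a • x := rfl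

lemma ofA_mul_ofV (a : A) (x : V) :
    ofA Δ lam κ a * ofV Δ lam κ x =
      mulVA Δ lam κ ((orbit k A x).rTensor A (Δ.comul a)) + ofA Δ lam κ (lam (x ⊗ₜ a)) := by
  have h := mk_rel Δ lam κ (Rel.act a x)
  rw [map_sub, map_mul] at h
  have hc : ∀ z : A ⊗[k] A, mk Δ lam κ (cross k x z) =
      mulVA Δ lam κ ((orbit k A x).rTensor A z) := by
    intro z
    induction z with
    | zero => simp
    | tmul a b => simp [cross, orbit, ofV, ofA]
    | add z z' h h' => rw [map_add, map_add, map_add, map_add, h, h']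
  rw [hc, sub_eq_iff_eq_add'] at h
  exact h

/-- The universal property of `H_{0,κ}`. -/
noncomputable def lift {E : Type*} [Ring E] [Algebra k E] (ρ : A →ₐ[k] E) (φ : V →ₗ[k] E)
    (hact : ∀ a x, ρ a * φ x =
      TensorProduct.lift ((LinearMap.mul k E).compl₁₂ (φ ∘ₗ orbit k A x) ρ.toLinearMap)
        (Δ.comul a))
    (hcomm : ∀ x y, φ x * φ y - φ y * φ x =
      φ (kappaV κ (exteriorPower.ιMulti k 2 ![x, y])) +
        ρ (kappaA κ (exteriorPower.ιMulti k 2 ![x, y]))) :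
    DeformedSmash Δ 0 κ →ₐ[k] E :=
  RingQuot.liftAlgHom k ⟨TensorAlgebra.lift k (φ.coprod ρ.toLinearMap), fun s t h => by
    cases h with
    | one => simp [tA]
    | mul a a' => simp [tA]
    | act a x =>
      have hc : ∀ z : A ⊗[k] A,
          TensorAlgebra.lift k (φ.coprod ρ.toLinearMap) (cross k x z) =
          TensorProduct.lift ((LinearMap.mul k E).compl₁₂ (φ ∘ₗ orbit k A x) ρ.toLinearMap) z := by
        intro z
        induction z with
        | zero => simp
        | tmul a b => simp [cross, orbit, tV, tA]
        | add z z' h h' => rw [map_add, map_add, map_add, h, h']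
      rw [map_sub, hc, ← hact]
      simp [tA, tV]
    | comm x y => simpa [tV, kappaV, kappaA] using hcomm x y⟩

lemma lift_mk {E : Type*} [Ring E] [Algebra k E] (ρ : A →ₐ[k] E) (φ : V →ₗ[k] E) (hact) (hcomm)
    (x : TensorAlgebra k (V × A)) :
    lift Δ κ ρ φ hact hcomm (mk Δ 0 κ x) = TensorAlgebra.lift k (φ.coprod ρ.toLinearMap) x :=
  RingQuot.liftAlgHom_mkAlgHom_apply k _ _ _

@[simp]
lemma lift_ofV {E : Type*} [Ring E] [Algebra k E] (ρ : A →ₐ[k] E) (φ : V →ₗ[k] E) (hact) (hcomm)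
    (x : V) : lift Δ κ ρ φ hact hcomm (ofV Δ 0 κ x) = φ x := by
  rw [ofV, LinearMap.comp_apply]
  exact (lift_mk Δ κ ρ φ hact hcomm _).trans (by simp [tV])

@[simp]
lemma lift_ofA {E : Type*} [Ring E] [Algebra k E] (ρ : A →ₐ[k] E) (φ : V →ₗ[k] E) (hact) (hcomm)
    (a : A) : lift Δ κ ρ φ hact hcomm (ofA Δ 0 κ a) = ρ a := by
  rw [ofA, LinearMap.comp_apply]
  exact (lift_mk Δ κ ρ φ hact hcomm _).trans (by simp [tA])

/-! ### The length filtration and straightening -/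

/-- The subspace `k + V` of `H_{0,κ}`. -/
noncomputable def oneV : Submodule k (DeformedSmash Δ 0 κ) := 1 ⊔ LinearMap.range (ofV Δ 0 κ)

/-- The `n`-th step `(k + V)ⁿ A` of the filtration of `H_{0,κ}` by the number of factors
from `V`. -/
noncomputable def filt (n : ℕ) : Submodule k (DeformedSmash Δ 0 κ) :=
  oneV Δ κ ^ n * LinearMap.range (ofA Δ 0 κ)

lemma one_le_oneV : 1 ≤ oneV Δ κ := le_sup_left

lemma ofV_mem_oneV (x : V) : ofV Δ 0 κ x ∈ oneV Δ κ :=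
  (le_sup_right : LinearMap.range (ofV Δ 0 κ) ≤ oneV Δ κ) ⟨x, rfl⟩

lemma filt_succ (n : ℕ) : filt Δ κ (n + 1) = oneV Δ κ * filt Δ κ n := by
  rw [filt, filt, pow_succ', mul_assoc]

lemma filt_mono : Monotone (filt Δ κ) := by
  refine monotone_nat_of_le_succ fun n => ?_
  rw [filt_succ]
  calc filt Δ κ n = 1 * filt Δ κ n := (one_mul _).symm
    _ ≤ _ := mul_le_mul' (one_le_oneV Δ κ) le_rfl

lemma ofV_mul_mem_filt {n : ℕ} (x : V) {z : DeformedSmash Δ 0 κ} (hz : z ∈ filt Δ κ n) :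
    ofV Δ 0 κ x * z ∈ filt Δ κ (n + 1) := by
  rw [filt_succ]
  exact Submodule.mul_mem_mul (ofV_mem_oneV Δ κ x) hz

lemma rangeA_mul_rangeA :
    LinearMap.range (ofA Δ 0 κ) * LinearMap.range (ofA Δ 0 κ) ≤ LinearMap.range (ofA Δ 0 κ) := by
  rw [Submodule.mul_le]
  rintro _ ⟨a, rfl⟩ _ ⟨b, rfl⟩
  exact ⟨a * b, ofA_mul Δ 0 κ a b⟩

lemma rangeA_mul_oneV :
    LinearMap.range (ofA Δ 0 κ) * oneV Δ κ ≤ oneV Δ κ * LinearMap.range (ofA Δ 0 κ) := by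
  rw [oneV, Submodule.mul_sup, Submodule.sup_mul, mul_one, one_mul]
  refine sup_le_sup_left ?_ _
  rw [Submodule.mul_le]
  rintro _ ⟨a, rfl⟩ _ ⟨x, rfl⟩
  rw [ofA_mul_ofV, LinearMap.zero_apply, map_zero, add_zero]
  induction Δ.comul a with
  | zero => simp
  | tmul a b =>
    rw [LinearMap.rTensor_tmul, mulVA_tmul]
    exact Submodule.mul_mem_mul ⟨_, rfl⟩ ⟨_, rfl⟩
  | add z z' h h' =>
    rw [map_add, map_add]
    exact add_mem h h'

lemma rangeA_mul_filt (n : ℕ) : LinearMap.range (ofA Δ 0 κ) * filt Δ κ n ≤ filt Δ κ n := by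
  induction n with
  | zero => simpa [filt] using rangeA_mul_rangeA Δ κ
  | succ n ih =>
    rw [filt_succ, ← mul_assoc]
    refine (mul_le_mul' (rangeA_mul_oneV Δ κ) le_rfl).trans ?_
    rw [mul_assoc]
    exact mul_le_mul' le_rfl ih

lemma ofA_mul_mem_filt {n : ℕ} (a : A) {z : DeformedSmash Δ 0 κ} (hz : z ∈ filt Δ κ n) :
    ofA Δ 0 κ a * z ∈ filt Δ κ n :=
  rangeA_mul_filt Δ κ n (Submodule.mul_mem_mul ⟨a, rfl⟩ hz)

lemma ofA_mem_filt (a : A) (n : ℕ) : ofA Δ 0 κ a ∈ filt Δ κ n :=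
  filt_mono Δ κ n.zero_le (by rw [filt, pow_zero, one_mul]; exact ⟨a, rfl⟩)

lemma iSup_filt : ⨆ n, filt Δ κ n = ⊤ := by
  -- The union of the filtration is stable under left multiplication by the generators.
  have hdir : Directed (· ≤ ·) (filt Δ κ) := (filt_mono Δ κ).directed_le
  have key : ∀ t : TensorAlgebra k (V × A), ∀ z ∈ ⨆ n, filt Δ κ n,
      mk Δ 0 κ t * z ∈ ⨆ n, filt Δ κ n := by
    intro t
    induction t using TensorAlgebra.induction with
    | algebraMap r =>
      intro z hz
      rw [AlgHom.commutes, ← Algebra.smul_def]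
      exact Submodule.smul_mem _ _ hz
    | ι x =>
      intro z hz
      obtain ⟨n, hn⟩ := (Submodule.mem_iSup_of_directed _ hdir).1 hz
      rw [mk_ι, add_mul]
      exact Submodule.mem_iSup_of_mem (n + 1) (add_mem (ofV_mul_mem_filt Δ κ _ hn)
        (filt_mono Δ κ n.le_succ (ofA_mul_mem_filt Δ κ _ hn)))
    | mul s t hs ht =>
      intro z hz
      rw [map_mul, mul_assoc]
      exact hs _ (ht _ hz)
    | add s t hs ht =>
      intro z hz
      rw [map_add, add_mul]
      exact add_mem (hs _ hz) (ht _ hz)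
  rw [eq_top_iff]
  intro h _
  obtain ⟨t, rfl⟩ := RingQuot.mkAlgHom_surjective k (Rel Δ 0 κ) h
  have h1 := key t 1 (Submodule.mem_iSup_of_mem 0 (ofA_one Δ 0 κ ▸ ofA_mem_filt Δ κ 1 0))
  rwa [mul_one] at h1

section Words

variable {ι : Type v} (b : Module.Basis ι k V)

/-- The product in `H_{0,κ}` of a word in the basis vectors `b i`. -/
noncomputable def wordV (l : List ι) : DeformedSmash Δ 0 κ :=
  (l.map fun i => ofV Δ 0 κ (b i)).prod

lemma wordV_cons (i : ι) (l : List ι) :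
    wordV Δ κ b (i :: l) = ofV Δ 0 κ (b i) * wordV Δ κ b l := by
  simp [wordV]

lemma wordV_mul_mem_filt (l : List ι) (a : A) :
    wordV Δ κ b l * ofA Δ 0 κ a ∈ filt Δ κ l.length := by
  induction l with
  | nil => simpa [wordV] using ofA_mem_filt Δ κ a 0
  | cons i l ih =>
    rw [wordV_cons, mul_assoc]
    exact ofV_mul_mem_filt Δ κ _ ih

/-- Permuting the letters of a word changes it by an element of smaller filtration degree. -/
lemma wordV_sub_mem_filt_of_perm {l l' : List ι} (h : l.Perm l') (a : A) :
    wordV Δ κ b l * ofA Δ 0 κ a - wordV Δ κ b l' * ofA Δ 0 κ a ∈ filt Δ κ (l.length - 1) := by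
  induction h with
  | nil => simp
  | @cons i l₁ l₂ h ih =>
    rcases l₁ with - | ⟨j, l₁⟩
    · rw [h.symm.eq_nil, sub_self]
      exact zero_mem _
    · rw [wordV_cons, wordV_cons _ _ _ i l₂, mul_assoc, mul_assoc, ← mul_sub]
      exact ofV_mul_mem_filt Δ κ _ ih
  | swap i j l =>
    have e : wordV Δ κ b (j :: i :: l) * ofA Δ 0 κ a - wordV Δ κ b (i :: j :: l) * ofA Δ 0 κ a =
        (ofV Δ 0 κ (b j) * ofV Δ 0 κ (b i) - ofV Δ 0 κ (b i) * ofV Δ 0 κ (b j)) *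
          (wordV Δ κ b l * ofA Δ 0 κ a) := by
      simp only [wordV_cons, sub_mul, mul_assoc]
    rw [e, ofV_mul_sub, add_mul]
    have hl := wordV_mul_mem_filt Δ κ b l a
    exact add_mem (ofV_mul_mem_filt Δ κ _ hl)
      (filt_mono Δ κ l.length.le_succ (ofA_mul_mem_filt Δ κ _ hl))
  | trans h₁ _ ih₁ ih₂ =>
    rw [← h₁.length_eq] at ih₂
    simpa using add_mem ih₁ ih₂

variable [LinearOrder ι] {J : Type w} (c : Module.Basis J k A)

/-- The PBW monomials with at most `n` letters span the `n`-th step of the filtration. -/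
lemma span_pbwMonomial_eq_filt (n : ℕ) :
    Submodule.span k (pbwMonomial Δ 0 κ b c '' {p | (p.1 : List ι).length ≤ n}) =
      filt Δ κ n := by
  refine le_antisymm ?_ ?_
  · rw [Submodule.span_le]
    rintro _ ⟨p, hp, rfl⟩
    exact filt_mono Δ κ hp (wordV_mul_mem_filt Δ κ b _ _)
  induction n with
  | zero =>
    rw [filt, pow_zero, one_mul, LinearMap.range_eq_map, ← c.span_eq, Submodule.map_span,
      Submodule.span_le]
    rintro _ ⟨_, ⟨j, rfl⟩, rfl⟩
    exact Submodule.subset_span ⟨(⟨[], List.Pairwise.nil⟩, j), by simp, by simp [pbwMonomial]⟩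
  | succ n ih =>
    set S : ℕ → Submodule k (DeformedSmash Δ 0 κ) := fun n =>
      Submodule.span k (pbwMonomial Δ 0 κ b c '' {p | (p.1 : List ι).length ≤ n}) with hS
    have hmono : S n ≤ S (n + 1) :=
      Submodule.span_mono (Set.image_mono fun p hp => Nat.le_succ_of_le hp)
    change filt Δ κ n ≤ S n at ih
    change filt Δ κ (n + 1) ≤ S (n + 1)
    have hV : LinearMap.range (ofV Δ 0 κ) =
        Submodule.span k (Set.range fun i => ofV Δ 0 κ (b i)) := by
      rw [LinearMap.range_eq_map, ← b.span_eq, Submodule.map_span, ← Set.range_comp]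
      rfl
    rw [filt_succ]
    refine (mul_le_mul' le_rfl ih).trans ?_
    rw [oneV, Submodule.sup_mul, one_mul, sup_le_iff]
    refine ⟨hmono, ?_⟩
    rw [hV, hS, Submodule.span_mul_span, Submodule.span_le]
    rintro _ ⟨_, ⟨i, rfl⟩, _, ⟨⟨⟨l, hl⟩, j⟩, hp, rfl⟩, rfl⟩
    change l.length ≤ n at hp
    have e : ofV Δ 0 κ (b i) * pbwMonomial Δ 0 κ b c (⟨l, hl⟩, j) =
        wordV Δ κ b (i :: l) * ofA Δ 0 κ (c j) := by
      rw [wordV_cons, mul_assoc]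
      rfl
    -- Sort the word `i :: l`; the error terms are covered by the induction hypothesis.
    let l' := (i :: l).insertionSort (· ≤ ·)
    have hl' : l'.Pairwise (· ≤ ·) := List.pairwise_insertionSort _ _
    have hperm : (i :: l).Perm l' := (List.perm_insertionSort _ _).symm
    have h1 := wordV_sub_mem_filt_of_perm Δ κ b hperm (c j)
    have h2 : wordV Δ κ b l' * ofA Δ 0 κ (c j) ∈ S (n + 1) :=
      Submodule.subset_span ⟨(⟨l', hl'⟩, j), by
        change l'.length ≤ n + 1
        rw [← hperm.length_eq, List.length_cons]
        omega, rfl⟩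
    have h3 := add_mem (hmono (ih (filt_mono Δ κ (by simpa using hp) h1))) h2
    rw [sub_add_cancel] at h3
    change ofV Δ 0 κ (b i) * _ ∈ S (n + 1)
    rw [e]
    exact h3

lemma span_pbwMonomial : Submodule.span k (Set.range (pbwMonomial Δ 0 κ b c)) = ⊤ := by
  rw [eq_top_iff, ← iSup_filt, iSup_le_iff]
  intro n
  rw [← span_pbwMonomial_eq_filt Δ κ b c]
  exact Submodule.span_mono (Set.image_subset_range _ _)

end Words

end

end DeformedSmash

/-! ### Independence of the basis of `V` -/

namespace DeformedSmash

section

variable {k : Type u} [Field k] {A : Type w} [Ring A] [Algebra k A]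
  {V : Type v} [AddCommGroup V] [Module k V] [Module A V] [IsScalarTower k A V]
  (Δ : CocommCoproduct k A) (κ : ⋀[k]^2 V →ₗ[k] V × A)

/-- For finite-dimensional `V` and `A` the linear independence of the PBW monomials does not
depend on the basis of `V`: the monomials with at most `n` letters are equally many for any two
bases with the same index set, and they span the same `n`-th step of the filtration. -/
lemma linearIndependent_pbwMonomial_congr {ι : Type v} [LinearOrder ι] [Finite ι]
    {J : Type w} [Finite J] (b b' : Module.Basis ι k V) (c : Module.Basis J k A)
    (h : LinearIndependent k (pbwMonomial Δ 0 κ b' c)) :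
    LinearIndependent k (pbwMonomial Δ 0 κ b c) := by
  let P := {l : List ι // l.Pairwise (· ≤ ·)} × J
  let s : ℕ → Set P := fun n => {p | (p.1 : List ι).length ≤ n}
  have hfin : ∀ n, (s n).Finite := by
    intro n
    have h1 := ((List.finite_length_le ι n).prod (Set.finite_univ (α := J)))
    refine Set.Finite.of_finite_image (f := fun p : P => ((p.1 : List ι), p.2))
      (h1.subset ?_) ?_
    · rintro _ ⟨p, hp, rfl⟩
      exact ⟨hp, trivial⟩
    · intro p _ q _ hpq
      exact Prod.ext (Subtype.ext (Prod.ext_iff.1 hpq).1) (Prod.ext_iff.1 hpq).2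
  have hstep : ∀ n, LinearIndependent k (fun p : s n => pbwMonomial Δ 0 κ b c p) := by
    intro n
    have := (hfin n).fintype
    have h' : LinearIndependent k (fun p : s n => pbwMonomial Δ 0 κ b' c p) :=
      h.comp _ Subtype.val_injective
    have hr : ∀ b : Module.Basis ι k V, Submodule.span k
        (Set.range fun p : s n => pbwMonomial Δ 0 κ b c p) = filt Δ κ n := by
      intro b
      rw [← span_pbwMonomial_eq_filt Δ κ b c, ← Set.image_eq_range]
    rw [linearIndependent_iff_card_eq_finrank_span, Set.finrank, hr] at h' ⊢
    exact h'
  rw [linearIndependent_iff_finset_linearIndependent]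
  intro t
  have ht : ∀ p : t, (p : P) ∈ s (t.sup fun p => (p.1 : List ι).length) := fun p =>
    Finset.le_sup (f := fun p : P => (p.1 : List ι).length) p.2
  exact (hstep _).comp (fun p : t => ⟨p, ht p⟩) fun p q hpq =>
    Subtype.ext (congrArg (fun z : s _ => (z : P)) hpq)

end

end DeformedSmash

/-! ### The actions of `NC_W(d)` and `S(V) # A` on `S(V) ⊗ A` -/

namespace NilCoxeter

open DeformedSmash

section

variable {k : Type u} [CommRing k] {I : Type w} {M : CoxeterMatrix I} {d : I → ℕ}
  {V : Type v} [AddCommGroup V] [Module k V] [Module (NilCoxeter k M d) V]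
  [IsScalarTower k (NilCoxeter k M d) V] (κ : ⋀[k]^2 V →ₗ[k] V × NilCoxeter k M d)

/-- For `λ = 0`, the relation between `A` and `V` need only be checked for the generators. -/
noncomputable def smashLift {E : Type*} [Ring E] [Algebra k E] (ρ : NilCoxeter k M d →ₐ[k] E)
    (φ : V →ₗ[k] E) (hact : ∀ i x, ρ (T k M d i) * φ x = φ (T k M d i • x) * ρ (T k M d i))
    (hcomm : ∀ x y, φ x * φ y - φ y * φ x =
      φ (kappaV κ (exteriorPower.ιMulti k 2 ![x, y])) +
        ρ (kappaA κ (exteriorPower.ιMulti k 2 ![x, y]))) :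
    DeformedSmash (coproduct k M d) 0 κ →ₐ[k] E :=
  DeformedSmash.lift (coproduct k M d) κ ρ φ (by
    have hw : ∀ (l : List I) x,
        ρ (word k M d l) * φ x = φ (word k M d l • x) * ρ (word k M d l) := by
      intro l
      induction l with
      | nil => simp
      | cons i l ih =>
        intro x
        rw [word_cons, map_mul, mul_assoc, ih, ← mul_assoc, hact, mul_assoc, mul_smul]
    intro a x
    have : (LinearMap.mulRight k (φ x)) ∘ₗ ρ.toLinearMap =
        TensorProduct.lift ((LinearMap.mul k E).compl₁₂ (φ ∘ₗ orbit k _ x) ρ.toLinearMap) ∘ₗ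
          (coproduct k M d).comul.toLinearMap := by
      refine linearMap_ext_word fun l => ?_
      simp [comul_word, hw]
    exact LinearMap.congr_fun this a) hcomm

section Commutative

variable {ι : Type v} (b : Module.Basis ι k V)

/-- The inclusion of `V` into its symmetric algebra, realized as the polynomial ring on a basis. -/
noncomputable def toPoly : V →ₗ[k] MvPolynomial ι k := b.constr k MvPolynomial.X

@[simp]
lemma toPoly_basis (i : ι) : toPoly b (b i) = MvPolynomial.X i := by simp [toPoly]

/-- The algebra endomorphism of the symmetric algebra of `V` induced by the action of `a` on
`V`. -/
noncomputable def polyMap (a : NilCoxeter k M d) : MvPolynomial ι k →ₐ[k] MvPolynomial ι k :=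
  MvPolynomial.aeval fun i => toPoly b (a • b i)

lemma polyMap_toPoly (a : NilCoxeter k M d) (x : V) :
    polyMap b a (toPoly b x) = toPoly b (a • x) := by
  have : (polyMap b a).toLinearMap ∘ₗ toPoly b = toPoly b ∘ₗ Algebra.lsmul k k V a :=
    b.ext fun i => by simp [polyMap]
  exact LinearMap.congr_fun this x

lemma polyMap_mul (a a' : NilCoxeter k M d) :
    polyMap b (a * a') = (polyMap b a).comp (polyMap b a') :=
  MvPolynomial.algHom_ext fun i => by
    rw [AlgHom.comp_apply, ← toPoly_basis b, polyMap_toPoly, polyMap_toPoly, polyMap_toPoly,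
      mul_smul]

/-- The operator `S(a) ⊗ a` on `S(V) ⊗ A`. It is multiplicative, though not linear, in `a`, and it
is the action of `a` whenever `a` is grouplike. -/
noncomputable def diagAct :
    NilCoxeter k M d →* Module.End k (MvPolynomial ι k ⊗[k] NilCoxeter k M d) where
  toFun a := TensorProduct.map (polyMap b a).toLinearMap (LinearMap.mulLeft k a)
  map_one' := by
    have h : polyMap b (1 : NilCoxeter k M d) = AlgHom.id k _ :=
      MvPolynomial.algHom_ext fun i => by simp [polyMap]
    rw [h, LinearMap.mulLeft_one]
    exact TensorProduct.map_id
  map_mul' a a' := by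
    rw [polyMap_mul, LinearMap.mulLeft_mul, AlgHom.comp_toLinearMap, TensorProduct.map_comp]
    rfl

lemma diagAct_tmul (a a' : NilCoxeter k M d) (p : MvPolynomial ι k) :
    diagAct b a (p ⊗ₜ a') = polyMap b a p ⊗ₜ (a * a') := rfl

/-- The action of `A` on `S(V) ⊗ A` in which each `T_i` acts diagonally. -/
noncomputable def polyRep :
    NilCoxeter k M d →ₐ[k] Module.End k (MvPolynomial ι k ⊗[k] NilCoxeter k M d) :=
  NilCoxeter.lift (fun i => diagAct b (T k M d i))
    (fun i j h => by
      have e' := congrArg (diagAct b) (word_alternatingWord k M d h)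
      rw [word, word, map_list_prod, map_list_prod, List.map_map, List.map_map] at e'
      exact e')
    (fun i => by
      rw [← map_pow, T_pow]
      change TensorProduct.map _ _ = _
      rw [LinearMap.mulLeft_zero_eq_zero, TensorProduct.map_zero_right])

@[simp]
lemma polyRep_T (i : I) : polyRep b (T k M d i) = diagAct b (T k M d i) :=
  lift_T k M d _ _ _ i

lemma polyRep_word (l : List I) :
    polyRep b (word k M d l) = diagAct b (word k M d l) := by
  rw [algHom_word, word, map_list_prod, List.map_map]
  simp [Function.comp_def]

lemma polyRep_one_tmul_one (a : NilCoxeter k M d) :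
    polyRep b a (1 ⊗ₜ 1) = 1 ⊗ₜ a := by
  have : LinearMap.applyₗ (R := k) (1 ⊗ₜ 1) ∘ₗ (polyRep b).toLinearMap =
      TensorProduct.mk k (MvPolynomial ι k) (NilCoxeter k M d) 1 := by
    refine linearMap_ext_word fun l => ?_
    simp [polyRep_word, diagAct_tmul]
  exact LinearMap.congr_fun this a

/-- The multiplication operators of elements of `V` on `S(V) ⊗ A`. -/
noncomputable def mulOp :
    V →ₗ[k] Module.End k (MvPolynomial ι k ⊗[k] NilCoxeter k M d) :=
  LinearMap.rTensorHom (NilCoxeter k M d) ∘ₗ LinearMap.mul k (MvPolynomial ι k) ∘ₗ toPoly b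

omit [Module (NilCoxeter k M d) V] [IsScalarTower k (NilCoxeter k M d) V] in
@[simp]
lemma mulOp_tmul (x : V) (p : MvPolynomial ι k) (a : NilCoxeter k M d) :
    mulOp b x (p ⊗ₜ a) = (toPoly b x * p) ⊗ₜ a := rfl

lemma polyRep_T_mul_mulOp (i : I) (x : V) :
    polyRep b (T k M d i) * mulOp b x = mulOp b (T k M d i • x) * polyRep b (T k M d i) := by
  rw [polyRep_T]
  refine TensorProduct.ext' fun p a => ?_
  simp [diagAct_tmul, polyMap_toPoly]

/-- If `H_{0,κ}` acts on `S(V) ⊗ A` in such a way that the monomial of a sorted word `i :: l`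
arises from that of `l` by applying `b i`, then the PBW monomials applied to `1 ⊗ 1` give the
monomial basis of `S(V) ⊗ A`. -/
lemma linearIndependent_pbwMonomial_of_rep [LinearOrder ι] {J : Type (max u w)}
    (c : Module.Basis J k (NilCoxeter k M d))
    (Φ : DeformedSmash (coproduct k M d) 0 κ →ₐ[k]
      Module.End k (MvPolynomial ι k ⊗[k] NilCoxeter k M d))
    (hA : ∀ a, Φ (ofA _ 0 κ a) = polyRep b a)
    (hV : ∀ (i : ι) (l : List ι), (i :: l).Pairwise (· ≤ ·) → ∀ a : NilCoxeter k M d,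
      Φ (ofV _ 0 κ (b i)) (MvPolynomial.monomial (Multiset.toFinsupp (l : Multiset ι)) 1 ⊗ₜ a) =
        (MvPolynomial.X i * MvPolynomial.monomial (Multiset.toFinsupp (l : Multiset ι)) 1) ⊗ₜ a) :
    LinearIndependent k (pbwMonomial (coproduct k M d) 0 κ b c) := by
  let ev : DeformedSmash (coproduct k M d) 0 κ →ₗ[k] MvPolynomial ι k ⊗[k] NilCoxeter k M d :=
    LinearMap.applyₗ (R := k) (1 ⊗ₜ 1) ∘ₗ Φ.toLinearMap
  refine LinearIndependent.of_comp ev ?_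
  let f : {l : List ι // l.Pairwise (· ≤ ·)} × J → (ι →₀ ℕ) × J :=
    Prod.map (fun l => Multiset.toFinsupp (l : Multiset ι)) id
  have hf : Function.Injective f := by
    refine Function.Injective.prodMap (fun l l' h => ?_) Function.injective_id
    have h' := Multiset.toFinsupp.injective h
    exact Subtype.ext ((Multiset.coe_eq_coe.1 h').eq_of_pairwise' l.2 l'.2)
  have hb := ((MvPolynomial.basisMonomials ι k).tensorProduct c).linearIndependent.comp f hf
  have key : ∀ l : List ι, l.Pairwise (· ≤ ·) → ∀ a : NilCoxeter k M d,
      Φ (wordV _ κ b l * ofA _ 0 κ a) (1 ⊗ₜ 1) =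
      MvPolynomial.monomial (Multiset.toFinsupp (l : Multiset ι)) 1 ⊗ₜ a := by
    intro l hl a
    induction l with
    | nil => simp [wordV, hA, polyRep_one_tmul_one]
    | cons i l ih =>
      rw [wordV_cons, mul_assoc, map_mul, Module.End.mul_apply, ih hl.of_cons, hV i l hl,
        ← Multiset.cons_coe, ← Multiset.singleton_add, map_add, Multiset.toFinsupp_singleton]
      simp [MvPolynomial.X, MvPolynomial.monomial_mul]
  have e : ev ∘ pbwMonomial _ 0 κ b c =
      (MvPolynomial.basisMonomials ι k).tensorProduct c ∘ f := by
    funext ⟨⟨l, hl⟩, j⟩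
    simp only [Function.comp_apply, Module.Basis.tensorProduct_apply, f, Prod.map,
      MvPolynomial.coe_basisMonomials, id]
    exact key l hl (c j)
  rw [e]
  exact hb

/-- The action of `S(V) # A` on `S(V) ⊗ A`. -/
noncomputable def polySmashRep (h0 : κ = 0) :
    DeformedSmash (coproduct k M d) 0 κ →ₐ[k]
      Module.End k (MvPolynomial ι k ⊗[k] NilCoxeter k M d) :=
  smashLift (E := Module.End k (MvPolynomial ι k ⊗[k] NilCoxeter k M d)) κ (polyRep b) (mulOp b)
    (polyRep_T_mul_mulOp b)
    (fun x y => by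
      subst h0
      refine TensorProduct.ext' fun p a => ?_
      simp [kappaV, kappaA, mul_left_comm])

lemma hasPBW_of_eq_zero (h0 : κ = 0) : HasPBW (coproduct k M d) 0 κ := fun ι _ _ b c => by
  refine ⟨linearIndependent_pbwMonomial_of_rep κ b c (polySmashRep κ b h0)
    (fun a => lift_ofA _ _ _ _ _ _ _) (fun i l _ a => ?_), span_pbwMonomial _ κ b c⟩
  have h : polySmashRep κ b h0 (ofV _ 0 κ (b i)) = mulOp b (b i) := lift_ofV _ _ _ _ _ _ _
  rw [h, mulOp_tmul, toPoly_basis]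

end Commutative

end

end NilCoxeter

/-! ### Consequences of the PBW property -/

namespace DeformedSmash

variable {k : Type u} [Field k] {A : Type w} [Ring A] [Algebra k A]
  {V : Type v} [AddCommGroup V] [Module k V] [Module A V] [IsScalarTower k A V]
  {Δ : CocommCoproduct k A} {lam : V ⊗[k] A →ₗ[k] A} {κ : ⋀[k]^2 V →ₗ[k] V × A}

/-- Under the PBW property, `V ⊗ A ⊕ A` embeds into `H_{λ,κ}`. -/
lemma HasPBW.injective (h : HasPBW Δ lam κ) :
    Function.Injective ((mulVA Δ lam κ).coprod (ofA Δ lam κ)) := by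
  let b := Module.Basis.ofVectorSpace k V
  let c := Module.Basis.ofVectorSpace k A
  classical
  let _ := linearOrderOfSTO (WellOrderingRel (α := Module.Basis.ofVectorSpaceIndex k V))
  obtain ⟨hli, -⟩ := h _ _ b c
  let B := (b.tensorProduct c).prod c
  let f : (Module.Basis.ofVectorSpaceIndex k V × Module.Basis.ofVectorSpaceIndex k A) ⊕
      Module.Basis.ofVectorSpaceIndex k A →
      {l : List (Module.Basis.ofVectorSpaceIndex k V) // l.Pairwise (· ≤ ·)} ×
        Module.Basis.ofVectorSpaceIndex k A :=
    Sum.elim (fun p => (⟨[p.1], List.pairwise_singleton _ _⟩, p.2))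
      (fun j => (⟨[], List.Pairwise.nil⟩, j))
  have hf : Function.Injective f := by
    rintro (⟨i, j⟩ | j) (⟨i', j'⟩ | j') h <;> simp_all [f]
  have e : (mulVA Δ lam κ).coprod (ofA Δ lam κ) ∘ B = pbwMonomial Δ lam κ b c ∘ f := by
    funext p
    rcases p with ⟨i, j⟩ | j <;> simp [B, f, pbwMonomial]
  have hB : LinearIndependent k ((mulVA Δ lam κ).coprod (ofA Δ lam κ) ∘ B) := e ▸ hli.comp f hf
  intro x y hxy
  apply B.repr.injective
  apply hB
  rw [← Finsupp.apply_linearCombination, ← Finsupp.apply_linearCombination,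
    B.linearCombination_repr, B.linearCombination_repr, hxy]

end DeformedSmash

namespace NilCoxeter

open DeformedSmash

section

variable {k : Type u} [Field k] {I : Type w} {M : CoxeterMatrix I} {d : I → ℕ}
  {V : Type v} [AddCommGroup V] [Module k V] [Module (NilCoxeter k M d) V]
  [IsScalarTower k (NilCoxeter k M d) V] {κ : ⋀[k]^2 V →ₗ[k] V × NilCoxeter k M d}

variable (κ) in
lemma ofA_T_mul_ofV (i : I) (x : V) :
    ofA (coproduct k M d) 0 κ (T k M d i) * ofV _ 0 κ x =
      ofV _ 0 κ (T k M d i • x) * ofA _ 0 κ (T k M d i) := by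
  rw [ofA_mul_ofV]
  change mulVA _ 0 κ (LinearMap.rTensor _ _ (comul k M d (T k M d i))) + _ = _
  simp

/-- The PBW property forces `κ` to be compatible with the action of the generators: this is
`T_i [x, y] = [T_i x, T_i y] T_i` in normal form. -/
lemma compat_of_hasPBW (h : HasPBW (coproduct k M d) 0 κ) (i : I) (x y : V) :
    (T k M d i • kappaV κ (exteriorPower.ιMulti k 2 ![x, y])) ⊗ₜ[k] T k M d i =
      kappaV κ (exteriorPower.ιMulti k 2 ![T k M d i • x, T k M d i • y]) ⊗ₜ[k] T k M d i ∧
    T k M d i * kappaA κ (exteriorPower.ιMulti k 2 ![x, y]) =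
      kappaA κ (exteriorPower.ιMulti k 2 ![T k M d i • x, T k M d i • y]) * T k M d i := by
  rw [← Prod.mk.injEq]
  apply h.injective
  simp only [LinearMap.coprod_apply, mulVA_tmul, ofA_mul]
  rw [← ofA_T_mul_ofV, ← mul_add, ← add_mul, ← ofV_mul_sub, ← ofV_mul_sub]
  have ht : ∀ x y, ofA (coproduct k M d) 0 κ (T k M d i) * (ofV _ 0 κ x * ofV _ 0 κ y) =
      ofV _ 0 κ (T k M d i • x) * ofV _ 0 κ (T k M d i • y) * ofA _ 0 κ (T k M d i) := by
    intro x y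
    rw [← mul_assoc, ofA_T_mul_ofV, mul_assoc, ofA_T_mul_ofV, mul_assoc]
  rw [mul_sub, sub_mul, ht, ht]

variable (k M d V) in
/-- The linear endomorphism of `V ⊗ A` given by `v ⊗ a ↦ ∑ a₍₁₎(v) ⊗ a₍₂₎`. -/
noncomputable def twist :
    V ⊗[k] NilCoxeter k M d →ₗ[k] V ⊗[k] NilCoxeter k M d :=
  TensorProduct.lift (LinearMap.mk₂ k
    (fun x a => (orbit k _ x).rTensor _ ((coproduct k M d).comul a))
    (fun x x' a => by
      have : orbit k (NilCoxeter k M d) (x + x') = orbit k _ x + orbit k _ x' := by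
        ext; simp
      rw [this, LinearMap.rTensor_add, LinearMap.add_apply])
    (fun r x a => by
      have : orbit k (NilCoxeter k M d) (r • x) = r • orbit k _ x := by
        ext a
        simp [smul_algebra_smul_comm]
      rw [this, LinearMap.rTensor_smul, LinearMap.smul_apply])
    (fun x a a' => by rw [map_add, map_add])
    (fun r x a => by rw [map_smul, map_smul]))

lemma twist_tmul (x : V) (a : NilCoxeter k M d) :
    twist k M d V (x ⊗ₜ a) = (orbit k _ x).rTensor _ ((coproduct k M d).comul a) := rfl

lemma twist_tmul_word (x : V) (l : List I) :
    twist k M d V (x ⊗ₜ word k M d l) = (word k M d l • x) ⊗ₜ word k M d l := by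
  rw [twist_tmul, comul_word, LinearMap.rTensor_tmul, orbit_apply]

/-- `v ⊗ T_w ↦ T_w v ⊗ T_w` is nilpotent on the span of the `v ⊗ T_w` for nonempty words `w`, so
that it has no nonzero fixed points there. -/
lemma eq_zero_of_twist_eq {n : ℕ} (hn : (maxIdeal k M d).asIdeal ^ n = ⊥)
    {z : V ⊗[k] NilCoxeter k M d}
    (hz : z ∈ Submodule.span k {t | ∃ (x : V) (l : List I), l ≠ [] ∧ x ⊗ₜ word k M d l = t})
    (h : twist k M d V z = z) : z = 0 := by
  have h1 : ((twist k M d V) ^ n) z = 0 := by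
    have : Submodule.span k {t | ∃ (x : V) (l : List I), l ≠ [] ∧ x ⊗ₜ word k M d l = t} ≤
        LinearMap.ker ((twist k M d V) ^ n) := by
      rw [Submodule.span_le]
      rintro _ ⟨x, l, hl, rfl⟩
      have hp : ∀ m : ℕ, ((twist k M d V) ^ m) (x ⊗ₜ word k M d l) =
          (word k M d l ^ m • x) ⊗ₜ word k M d l := by
        intro m
        induction m with
        | zero => simp
        | succ m ih => rw [pow_succ', Module.End.mul_apply, ih, twist_tmul_word, smul_smul,
            pow_succ']
      rw [SetLike.mem_coe, LinearMap.mem_ker, hp, word_pow_eq_zero hn hl, zero_smul,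
        TensorProduct.zero_tmul]
    exact this hz
  have h2 : ∀ m : ℕ, ((twist k M d V) ^ m) z = z := by
    intro m
    induction m with
    | zero => rfl
    | succ m ih => rw [pow_succ', Module.End.mul_apply, ih, h]
  rw [← h1, h2]

variable (k M d) in
/-- Every element of `A` is the sum of a scalar and a combination of nonempty words. -/
lemma exists_eq_smul_one_add (a : NilCoxeter k M d) :
    ∃ (r : k) (a' : NilCoxeter k M d),
      a' ∈ Submodule.span k (word k M d '' {l | l ≠ []}) ∧ a = r • 1 + a' := by
  have h : a ∈ Submodule.span k {1} ⊔ Submodule.span k (word k M d '' {l | l ≠ []}) := by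
    have : (⊤ : Submodule k (NilCoxeter k M d)) ≤ Submodule.span k {1} ⊔
        Submodule.span k (word k M d '' {l | l ≠ []}) := by
      rw [← span_range_word, ← Submodule.span_union, Submodule.span_le]
      rintro _ ⟨l, rfl⟩
      by_cases hl : l = []
      · exact Submodule.subset_span (Or.inl (by simp [hl]))
      · exact Submodule.subset_span (Or.inr ⟨l, hl, rfl⟩)
    exact this trivial
  obtain ⟨y, hy, a', ha', rfl⟩ := Submodule.mem_sup.1 h
  obtain ⟨r, rfl⟩ := Submodule.mem_span_singleton.1 hy
  exact ⟨r, a', ha', rfl⟩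

/-- The Jacobi identity in `H_{0,κ}` for `κ_V = 0`, in normal form. -/
lemma jacobi_of_hasPBW (h : HasPBW (coproduct k M d) 0 κ) (hV : kappaV κ = 0) (x y z : V) :
    twist k M d V (x ⊗ₜ kappaA κ (exteriorPower.ιMulti k 2 ![y, z]) +
        y ⊗ₜ kappaA κ (exteriorPower.ιMulti k 2 ![z, x]) +
        z ⊗ₜ kappaA κ (exteriorPower.ιMulti k 2 ![x, y])) =
      x ⊗ₜ kappaA κ (exteriorPower.ιMulti k 2 ![y, z]) +
        y ⊗ₜ kappaA κ (exteriorPower.ιMulti k 2 ![z, x]) +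
        z ⊗ₜ kappaA κ (exteriorPower.ιMulti k 2 ![x, y]) := by
  have hinj : Function.Injective (mulVA (coproduct k M d) 0 κ) := fun p q hpq => by
    have := @HasPBW.injective _ _ _ _ _ _ _ _ _ _ _ _ _ h (p, 0) (q, 0) (by simpa using hpq)
    exact (Prod.ext_iff.1 this).1
  have hc : ∀ x y, ofA (coproduct k M d) 0 κ (kappaA κ (exteriorPower.ιMulti k 2 ![x, y])) =
      ofV _ 0 κ x * ofV _ 0 κ y - ofV _ 0 κ y * ofV _ 0 κ x := by
    intro x y
    rw [ofV_mul_sub, hV]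
    simp
  have ht : ∀ x a, mulVA (coproduct k M d) 0 κ (twist k M d V (x ⊗ₜ a)) =
      ofA _ 0 κ a * ofV _ 0 κ x := by
    intro x a
    rw [ofA_mul_ofV, twist_tmul]
    simp
  apply hinj
  simp only [map_add, ht, mulVA_tmul, hc]
  noncomm_ring

/-- By the Jacobi identity, `κ_A` takes scalar values if `dim V > 2`. -/
lemma kappaA_mem_scalars {n : ℕ} (hn : (maxIdeal k M d).asIdeal ^ n = ⊥)
    (h : HasPBW (coproduct k M d) 0 κ) (hV : kappaV κ = 0) (hr : 2 < Module.rank k V) (x y : V) :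
    ∃ r : k, kappaA κ (exteriorPower.ιMulti k 2 ![x, y]) = r • 1 := by
  obtain ⟨z, hz⟩ : ∃ z, z ∉ Submodule.span k ({x, y} : Set V) := by
    by_contra! hall
    have htop : Submodule.span k ({x, y} : Set V) = ⊤ := (Submodule.eq_top_iff').2 hall
    have h1 := rank_span_le (R := k) ({x, y} : Set V)
    rw [htop, rank_top] at h1
    have h2 : Cardinal.mk ({x, y} : Set V) ≤ 2 := by
      refine (Cardinal.mk_insert_le).trans ?_
      rw [Cardinal.mk_singleton]
      exact le_of_eq one_add_one_eq_two
    exact absurd (h1.trans h2) (not_le.2 hr)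
  obtain ⟨f, hfz, hf⟩ := Submodule.exists_le_ker_of_notMem hz
  obtain ⟨r₁, a₁, h₁, e₁⟩ :=
    exists_eq_smul_one_add k M d (kappaA κ (exteriorPower.ιMulti k 2 ![y, z]))
  obtain ⟨r₂, a₂, h₂, e₂⟩ :=
    exists_eq_smul_one_add k M d (kappaA κ (exteriorPower.ιMulti k 2 ![z, x]))
  obtain ⟨r₃, a₃, h₃, e₃⟩ :=
    exists_eq_smul_one_add k M d (kappaA κ (exteriorPower.ιMulti k 2 ![x, y]))
  have hJ := jacobi_of_hasPBW h hV x y z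
  have h1 : ∀ (r : k) (v : V), twist k M d V (v ⊗ₜ (r • 1)) = v ⊗ₜ (r • 1) := by
    intro r v
    have := twist_tmul_word (k := k) (M := M) (d := d) v []
    rw [word_nil, one_smul] at this
    rw [TensorProduct.tmul_smul, map_smul, this]
  -- Scalars are fixed by `twist`, hence drop out of the Jacobi identity.
  have h0 : x ⊗ₜ[k] a₁ + y ⊗ₜ[k] a₂ + z ⊗ₜ[k] a₃ = 0 := by
    have hS : ∀ (v : V), ∀ a ∈ Submodule.span k (word k M d '' {l | l ≠ []}), v ⊗ₜ[k] a ∈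
        Submodule.span k {t | ∃ (x : V) (l : List I), l ≠ [] ∧ x ⊗ₜ word k M d l = t} := by
      intro v a ha
      have : Submodule.span k (word k M d '' {l | l ≠ []}) ≤ (Submodule.span k
          {t | ∃ (x : V) (l : List I), l ≠ [] ∧ x ⊗ₜ word k M d l = t}).comap
          (TensorProduct.mk k V (NilCoxeter k M d) v) := by
        rw [Submodule.span_le]
        rintro _ ⟨l, hl, rfl⟩
        exact Submodule.subset_span ⟨v, l, hl, rfl⟩
      exact this ha
    refine eq_zero_of_twist_eq hn (add_mem (add_mem (hS _ _ h₁) (hS _ _ h₂)) (hS _ _ h₃)) ?_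
    rw [e₁, e₂, e₃] at hJ
    simp only [TensorProduct.tmul_add, map_add, h1] at hJ ⊢
    rw [← sub_eq_zero] at hJ ⊢
    rw [← hJ]
    abel
  -- A linear form that vanishes on `x` and `y` but not on `z` extracts the last component.
  have h2 := congrArg (TensorProduct.lid k (NilCoxeter k M d) ∘ f.rTensor (NilCoxeter k M d)) h0
  have hx : f x = 0 := hf (Submodule.subset_span (Or.inl rfl))
  have hy : f y = 0 := hf (Submodule.subset_span (Or.inr rfl))
  simp [hx, hy, hfz] at h2
  exact ⟨r₃, by rw [e₃, h2, add_zero]⟩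

lemma kappaA_eq_zero_of_hasPBW {n : ℕ} (hd : ∀ i, 2 ≤ d i)
    (hn : (maxIdeal k M d).asIdeal ^ n = ⊥) (h : HasPBW (coproduct k M d) 0 κ)
    (hV : kappaV κ = 0) (hr : 2 < Module.rank k V) (i : I) : kappaA κ = 0 := by
  have hstep : ∀ x y, kappaA κ (exteriorPower.ιMulti k 2 ![T k M d i • x, T k M d i • y]) =
      kappaA κ (exteriorPower.ιMulti k 2 ![x, y]) := by
    intro x y
    have hc := (compat_of_hasPBW h i x y).2
    obtain ⟨r, hr₁⟩ := kappaA_mem_scalars hn h hV hr x y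
    obtain ⟨r', hr₂⟩ := kappaA_mem_scalars hn h hV hr (T k M d i • x) (T k M d i • y)
    rw [hr₁, hr₂, mul_smul_comm, smul_mul_assoc, mul_one, one_mul] at hc
    rw [hr₁, hr₂, smul_left_injective k (T_ne_zero k M hd i) hc]
  have hpow : ∀ (m : ℕ) x y, kappaA κ (exteriorPower.ιMulti k 2 ![x, y]) =
      kappaA κ (exteriorPower.ιMulti k 2 ![T k M d i ^ m • x, T k M d i ^ m • y]) := by
    intro m
    induction m with
    | zero => simp
    | succ m ih =>
      intro x y
      rw [← hstep, ih, pow_succ, mul_smul, mul_smul]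
  refine exteriorPower.linearMap_ext (AlternatingMap.ext fun v => ?_)
  have hv : v = ![v 0, v 1] := by
    funext j
    fin_cases j <;> rfl
  have h0 : exteriorPower.ιMulti k 2 ![(0 : V), 0] = 0 :=
    AlternatingMap.map_coord_zero _ 0 rfl
  simp only [LinearMap.compAlternatingMap_apply, LinearMap.zero_apply]
  rw [hv, hpow (d i), T_pow, zero_smul, zero_smul, h0, map_zero]

/-- If `dim V ≤ 2`, the nilpotent operator `T_i` has rank at most one, so it kills `∧² V`. -/
lemma ιMulti_T_smul_eq_zero (hr : Module.rank k V ≤ 2) (i : I) (x y : V) :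
    exteriorPower.ιMulti k 2 ![T k M d i • x, T k M d i • y] = 0 := by
  refine AlternatingMap.map_linearDependent _ _ fun hli => ?_
  have hfin : Module.Finite k V := Module.rank_lt_aleph0_iff.1
    (hr.trans_lt (Cardinal.natCast_lt_aleph0 (n := 2)))
  have hle : Module.finrank k V ≤ 2 := Module.finrank_le_of_rank_le (by simpa using hr)
  have hspan := hli.span_eq_top_of_card_eq_finrank'
    (le_antisymm hli.fintype_card_le_finrank (by simpa using hle))
  have hsurj : Function.Surjective fun v : V => T k M d i • v := by
    have : LinearMap.range (Algebra.lsmul k k V (T k M d i)) = ⊤ := by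
      rw [eq_top_iff, ← hspan, Submodule.span_le]
      rintro _ ⟨j, rfl⟩
      fin_cases j
      · exact ⟨x, rfl⟩
      · exact ⟨y, rfl⟩
    exact LinearMap.range_eq_top.1 this
  have hit : ∀ m : ℕ, Function.Surjective fun v : V => T k M d i ^ m • v := by
    intro m
    induction m with
    | zero => exact fun v => ⟨v, by simp⟩
    | succ m ih =>
      have := ih.comp hsurj
      simpa [Function.comp_def, pow_succ, mul_smul] using this
  obtain ⟨v, hv⟩ := hit (d i) (T k M d i • x)
  refine hli.ne_zero 0 ?_
  simpa [T_pow] using hv.symm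

lemma range_le_prim_of_hasPBW (hd : ∀ i, 2 ≤ d i) (hr : Module.rank k V ≤ 2)
    (h : HasPBW (coproduct k M d) 0 κ) :
    LinearMap.range (kappaV κ) ≤ Prim k M d V ∧
      LinearMap.range (kappaA κ) ≤ Prim k M d (NilCoxeter k M d) := by
  have key : ∀ i x y, T k M d i • kappaV κ (exteriorPower.ιMulti k 2 ![x, y]) = 0 ∧
      T k M d i • kappaA κ (exteriorPower.ιMulti k 2 ![x, y]) = 0 := by
    intro i x y
    obtain ⟨h1, h2⟩ := compat_of_hasPBW h i x y
    rw [ιMulti_T_smul_eq_zero hr, map_zero] at h1 h2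
    refine ⟨?_, by simpa using h2⟩
    obtain ⟨f, hf, -⟩ := Submodule.exists_le_ker_of_notMem (p := (⊥ : Submodule k _))
      (v := T k M d i) (by simpa using T_ne_zero k M hd i)
    have h3 := congrArg (TensorProduct.rid k V ∘ f.lTensor V) h1
    simpa [hf] using h3
  have ht : ∀ v : Fin 2 → V, v = ![v 0, v 1] := fun v => by
    funext j
    fin_cases j <;> rfl
  constructor <;>
  · rw [LinearMap.range_eq_map, ← exteriorPower.ιMulti_span, Submodule.map_span,
      Submodule.span_le]
    rintro _ ⟨_, ⟨v, rfl⟩, rfl⟩ i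
    rw [ht v]
    first
      | exact (key i _ _).1
      | exact (key i _ _).2

end

end NilCoxeter

/-! ### Triangular bases -/

namespace NilCoxeter

open DeformedSmash

section

variable {k : Type u} [Field k] {I : Type w} {M : CoxeterMatrix I} {d : I → ℕ}
  {V : Type v} [AddCommGroup V] [Module k V] [Module (NilCoxeter k M d) V]
  [IsScalarTower k (NilCoxeter k M d) V]

omit [Module k V] [IsScalarTower k (NilCoxeter k M d) V] in
/-- A nonzero module over `NC_W(d)` has nonzero primitive vectors if `𝔪` is nilpotent. -/
lemma exists_ne_zero_mem_prim [Nontrivial V] {n : ℕ}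
    (hn : (maxIdeal k M d).asIdeal ^ n = ⊥) : ∃ e : V, e ≠ 0 ∧ ∀ i, T k M d i • e = 0 := by
  classical
  have hex : ∃ m : ℕ, ∀ l : List I, l.length = m → ∀ x : V, word k M d l • x = 0 :=
    ⟨n, fun l hl x => by rw [word_eq_zero hn hl.ge, zero_smul]⟩
  have hspec := Nat.find_spec hex
  have hmin := fun m => Nat.find_min (m := m) hex
  rcases hm : Nat.find hex with - | m
  · obtain ⟨x, hx⟩ := exists_ne (0 : V)
    exact absurd (by simpa using hspec [] (by simp [hm]) x) hx
  · have := hmin m (by omega)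
    push Not at this
    obtain ⟨l, hl, x, hx⟩ := this
    refine ⟨_, hx, fun i => ?_⟩
    rw [← mul_smul, ← word_cons]
    exact hspec (i :: l) (by simp [hl, hm]) x

/-- If `𝔪` is nilpotent and `dim V = 2`, the generators act by strictly triangular matrices in a
suitable basis. -/
lemma exists_basis_triangular (hV : Module.finrank k V = 2) {n : ℕ}
    (hn : (maxIdeal k M d).asIdeal ^ n = ⊥) :
    ∃ b : Module.Basis (Fin 2) k V, (∀ i, T k M d i • b 0 = 0) ∧
      ∀ i, ∃ s : k, T k M d i • b 1 = s • b 0 := by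
  have hfin : Module.Finite k V := Module.finite_of_finrank_eq_succ hV
  have : Nontrivial V := Module.nontrivial_of_finrank_eq_succ hV
  obtain ⟨e, he, hT⟩ := exists_ne_zero_mem_prim (V := V) hn
  obtain ⟨f, hf⟩ : ∃ f, f ∉ Submodule.span k {e} := by
    by_contra! h
    have h1 := finrank_span_singleton (K := k) he
    rw [(Submodule.eq_top_iff').2 h, finrank_top, hV] at h1
    omega
  have hli : LinearIndependent k ![e, f] := by
    rw [LinearIndependent.pair_iff' he]
    exact fun a ha => hf (Submodule.mem_span_singleton.2 ⟨a, ha⟩)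
  let b := basisOfLinearIndependentOfCardEqFinrank hli (by simp [hV])
  have hb : ⇑b = ![e, f] := coe_basisOfLinearIndependentOfCardEqFinrank _ _
  have hb0 : b 0 = e := by simp [hb]
  refine ⟨b, fun i => by rw [hb0, hT], fun i => ⟨b.repr (T k M d i • b 1) 0, ?_⟩⟩
  have hs := b.sum_repr (T k M d i • b 1)
  rw [Fin.sum_univ_two] at hs
  set r := b.repr (T k M d i • b 1) 1 with hr
  -- The second diagonal entry `r` of `T_i` vanishes since `T_i ^ d_i = 0`.
  have hcoord : b.coord 1 ∘ₗ Algebra.lsmul k k V (T k M d i) = r • b.coord 1 := by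
    refine b.ext fun j => ?_
    fin_cases j
    · change b.coord 1 (T k M d i • b 0) = r * b.coord 1 (b 0)
      rw [hb0, hT, ← hb0]
      simp
    · simp [hr]
  have hpow : ∀ m : ℕ, b.coord 1 (T k M d i ^ m • b 1) = r ^ m := by
    intro m
    induction m with
    | zero => simp
    | succ m ih =>
      rw [pow_succ', mul_smul]
      exact (LinearMap.congr_fun hcoord _).trans (by rw [LinearMap.smul_apply, ih, pow_succ']; rfl)
  have hr0 : r = 0 := by
    have := hpow (d i)
    rw [T_pow, zero_smul, map_zero] at this
    exact eq_zero_of_pow_eq_zero this.symm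
  rw [hr0, zero_smul, add_zero] at hs
  exact hs.symm

/-! ### The deformed action in dimension two -/

section Straightening

variable {R : Type*} [Ring R] [Algebra k R]

/-- In a ring with a given action `f₀` of `f` on elements without `e`: the expression for `f eᵐ`
that results from the relation `f e = e f - p e - q f - α`. -/
noncomputable def straightenPow (e f₀ α : R) (p q : k) : ℕ → R
  | 0 => f₀
  | m + 1 => e * straightenPow e f₀ α p q m - p • e ^ (m + 1) - q • straightenPow e f₀ α p q m -
      α * e ^ m

/-- An element `t` with `t f = f₁ t` that kills `e`, `α` and, in effect, `q f` kills all the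
correction terms of `straightenPow`, and hence passes through `f eᵐ` as if `f` and `e` commuted. -/
lemma mul_straightenPow {t e f₀ f₁ α : R} {p q : k} (he : t * e = 0) (hα : t * α = 0)
    (hf : t * f₀ = f₁ * t) (hq : q • f₁ = 0) (m : ℕ) :
    t * straightenPow e f₀ α p q m = f₁ * t * e ^ m := by
  induction m with
  | zero => rw [straightenPow, hf, pow_zero, mul_one]
  | succ m ih =>
    rw [straightenPow, pow_succ', mul_sub, mul_sub, mul_sub, mul_smul_comm, mul_smul_comm,
      ← mul_assoc, ← mul_assoc, ← mul_assoc, he, hα, ih, ← smul_mul_assoc, ← smul_mul_assoc,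
      ← smul_mul_assoc, hq, ← mul_assoc, mul_assoc f₁, he]
    simp

end Straightening

section Wedge

variable (k V) in
/-- The bilinear map `(x, y) ↦ x ∧ y`. -/
noncomputable def wedge : V →ₗ[k] V →ₗ[k] ⋀[k]^2 V :=
  LinearMap.mk₂ k (fun x y => exteriorPower.ιMulti k 2 ![x, y])
    (fun x x' y => Subtype.ext (by simp [ExteriorAlgebra.ιMulti_apply, add_mul]))
    (fun r x y => Subtype.ext (by simp [ExteriorAlgebra.ιMulti_apply]))
    (fun x y y' => Subtype.ext (by simp [ExteriorAlgebra.ιMulti_apply, mul_add]))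
    (fun r x y => Subtype.ext (by simp [ExteriorAlgebra.ιMulti_apply]))

lemma wedge_apply (x y : V) : wedge k V x y = exteriorPower.ιMulti k 2 ![x, y] := rfl

lemma wedge_self (x : V) : wedge k V x x = 0 :=
  (exteriorPower.ιMulti k 2).map_eq_zero_of_eq ![x, x] (i := 0) (j := 1) rfl (by simp)

lemma wedge_swap (x y : V) : wedge k V x y = -wedge k V y x :=
  Subtype.ext (by simp [wedge_apply, ExteriorAlgebra.ιMulti_apply,
    eq_neg_iff_add_eq_zero, ExteriorAlgebra.ι_add_mul_swap])

omit [Module (NilCoxeter k M d) V] [IsScalarTower k (NilCoxeter k M d) V] in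
/-- In dimension two, the commutator relation need only be checked for the two basis vectors. -/
lemma commutator_eq_of_basis {ι : Type*} (b : Module.Basis ι k V) {i₀ i₁ : ι}
    (hι : ∀ i, i = i₀ ∨ i = i₁) (κ : ⋀[k]^2 V →ₗ[k] V × NilCoxeter k M d)
    {R : Type*} [Ring R] [Algebra k R] (φ : V →ₗ[k] R) (ρ : NilCoxeter k M d →ₐ[k] R)
    (h : φ (b i₀) * φ (b i₁) - φ (b i₁) * φ (b i₀) =
      φ (kappaV κ (exteriorPower.ιMulti k 2 ![b i₀, b i₁])) +
        ρ (kappaA κ (exteriorPower.ιMulti k 2 ![b i₀, b i₁]))) (x y : V) :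
    φ x * φ y - φ y * φ x = φ (kappaV κ (exteriorPower.ιMulti k 2 ![x, y])) +
        ρ (kappaA κ (exteriorPower.ιMulti k 2 ![x, y])) := by
  let ψ : ⋀[k]^2 V →ₗ[k] R := φ ∘ₗ kappaV κ + ρ.toLinearMap ∘ₗ kappaA κ
  change φ (b i₀) * φ (b i₁) - φ (b i₁) * φ (b i₀) = ψ (wedge k V (b i₀) (b i₁)) at h
  have hbil : (LinearMap.mul k R).compl₁₂ φ φ - ((LinearMap.mul k R).compl₁₂ φ φ).flip =
      (wedge k V).compr₂ ψ := by
    refine b.ext fun i => b.ext fun j => ?_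
    change φ (b i) * φ (b j) - φ (b j) * φ (b i) = ψ (wedge k V (b i) (b j))
    rcases hι i with rfl | rfl <;> rcases hι j with rfl | rfl
    · simp [wedge_self]
    · exact h
    · rw [wedge_swap, map_neg, ← h, neg_sub]
    · simp [wedge_self]
  exact LinearMap.congr_fun (LinearMap.congr_fun hbil x) y

/-- In dimension two, an action of `H_{0,κ}` is given by an action of `A` and the images of two
basis vectors, subject to the relations among these. -/
noncomputable def smashLiftOfBasis {ι : Type*} (b : Module.Basis ι k V) {i₀ i₁ : ι}
    (hι : ∀ i, i = i₀ ∨ i = i₁) (κ : ⋀[k]^2 V →ₗ[k] V × NilCoxeter k M d)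
    {R : Type*} [Ring R] [Algebra k R] (ρ : NilCoxeter k M d →ₐ[k] R) (φ : V →ₗ[k] R)
    (hact : ∀ i j, ρ (T k M d i) * φ (b j) = φ (T k M d i • b j) * ρ (T k M d i))
    (hcomm : φ (b i₀) * φ (b i₁) - φ (b i₁) * φ (b i₀) =
      φ (kappaV κ (exteriorPower.ιMulti k 2 ![b i₀, b i₁])) +
        ρ (kappaA κ (exteriorPower.ιMulti k 2 ![b i₀, b i₁]))) :
    DeformedSmash (coproduct k M d) 0 κ →ₐ[k] R :=
  smashLift κ ρ φ
    (fun i x => by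
      have : LinearMap.mulLeft k (ρ (T k M d i)) ∘ₗ φ =
          LinearMap.mulRight k (ρ (T k M d i)) ∘ₗ φ ∘ₗ Algebra.lsmul k k V (T k M d i) :=
        b.ext fun j => hact i j
      exact LinearMap.congr_fun this x)
    (commutator_eq_of_basis b hι κ φ ρ hcomm)

end Wedge

section Triangular

variable {ι : Type v} (b : Module.Basis ι k V) (i₀ i₁ : ι) (p q : k) (α : NilCoxeter k M d)

/-- The deformed action of `f = b i₁` on `S(V) ⊗ A`: a monomial `eᵐ g`, with `e = b i₀` not
occurring in `g`, is sent to `f eᵐ g` as expanded in `straightenPow`. -/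
noncomputable def deformedOp : Module.End k (MvPolynomial ι k ⊗[k] NilCoxeter k M d) :=
  TensorProduct.lift ((MvPolynomial.basisMonomials ι k).constr k fun s =>
    straightenPow (mulOp b (b i₀)) (mulOp b (b i₁)) (polyRep b α) p q (s i₀) ∘ₗ
      TensorProduct.mk k _ _ (MvPolynomial.monomial (s.erase i₀) 1))

lemma deformedOp_monomial (s : ι →₀ ℕ) (a : NilCoxeter k M d) :
    deformedOp b i₀ i₁ p q α (MvPolynomial.monomial s 1 ⊗ₜ a) =
      straightenPow (mulOp b (b i₀)) (mulOp b (b i₁)) (polyRep b α) p q (s i₀)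
        (MvPolynomial.monomial (s.erase i₀) 1 ⊗ₜ a) := by
  have h := (MvPolynomial.basisMonomials ι k).constr_basis k (fun s =>
    straightenPow (mulOp b (b i₀)) (mulOp b (b i₁)) (polyRep b α) p q (s i₀) ∘ₗ
      TensorProduct.mk k _ _ (MvPolynomial.monomial (s.erase i₀) 1)) s
  rw [MvPolynomial.coe_basisMonomials] at h
  rw [deformedOp, TensorProduct.lift.tmul, h]
  rfl

omit [Module (NilCoxeter k M d) V] [IsScalarTower k (NilCoxeter k M d) V] in
lemma mulOp_pow_monomial (s : ι →₀ ℕ) (a : NilCoxeter k M d) (m : ℕ) :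
    (mulOp b (b i₀) ^ m) (MvPolynomial.monomial s 1 ⊗ₜ a) =
      MvPolynomial.monomial (Finsupp.single i₀ m + s) 1 ⊗ₜ a := by
  induction m with
  | zero => simp
  | succ m ih =>
    rw [pow_succ', Module.End.mul_apply, ih, mulOp_tmul, toPoly_basis, MvPolynomial.X,
      MvPolynomial.monomial_mul, one_mul, ← add_assoc, ← Finsupp.single_add, add_comm 1 m]

lemma end_ext_monomial {N : Type*} [AddCommGroup N] [Module k N]
    {f g : MvPolynomial ι k ⊗[k] NilCoxeter k M d →ₗ[k] N}
    (h : ∀ s a, f (MvPolynomial.monomial s 1 ⊗ₜ a) = g (MvPolynomial.monomial s 1 ⊗ₜ a)) :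
    f = g := by
  refine TensorProduct.ext ((MvPolynomial.basisMonomials ι k).ext fun s => ?_)
  rw [MvPolynomial.coe_basisMonomials]
  exact LinearMap.ext fun a => h s a

/-- The defining relation `f e = e f - p e - q f - α` of the deformed action. -/
lemma deformedOp_mul_mulOp :
    deformedOp b i₀ i₁ p q α * mulOp b (b i₀) =
      mulOp b (b i₀) * deformedOp b i₀ i₁ p q α - p • mulOp b (b i₀) -
        q • deformedOp b i₀ i₁ p q α - polyRep b α := by
  refine end_ext_monomial fun s a => ?_
  have h1 := mulOp_pow_monomial b i₀ s a 1
  rw [pow_one] at h1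
  have hm : (Finsupp.single i₀ 1 + s : ι →₀ ℕ) i₀ = s i₀ + 1 := by simp [add_comm]
  have he : (Finsupp.single i₀ 1 + s : ι →₀ ℕ).erase i₀ = s.erase i₀ := by simp [Finsupp.erase_add]
  have h2 := mulOp_pow_monomial b i₀ (s.erase i₀) a (s i₀)
  rw [Finsupp.single_add_erase] at h2
  simp only [Module.End.mul_apply, LinearMap.sub_apply, LinearMap.smul_apply]
  rw [h1, deformedOp_monomial, hm, he, deformedOp_monomial, ← h1, ← h2]
  simp [straightenPow, pow_succ']

variable {b i₀ i₁ p q α}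

/-- The deformed action is compatible with `T_i`, which kills `e`, `p e + q f` and `α`, hence also
`q T_i(f)`. -/
lemma polyRep_T_mul_deformedOp (i : I) (he : T k M d i • b i₀ = 0)
    (hu : T k M d i • (p • b i₀ + q • b i₁) = 0) (hα : T k M d i • α = 0) :
    polyRep b (T k M d i) * deformedOp b i₀ i₁ p q α =
      mulOp b (T k M d i • b i₁) * polyRep b (T k M d i) := by
  have he' : polyRep b (T k M d i) * mulOp b (b i₀) = 0 := by
    rw [polyRep_T_mul_mulOp, he, map_zero, zero_mul]
  have hq : q • mulOp (M := M) (d := d) b (T k M d i • b i₁) = 0 := by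
    rw [smul_add, smul_algebra_smul_comm, he, smul_zero, zero_add, smul_algebra_smul_comm] at hu
    rw [← map_smul, hu, map_zero]
  have hα' : polyRep b (T k M d i) * polyRep b α = 0 := by
    rw [← map_mul, ← smul_eq_mul, hα, map_zero]
  refine end_ext_monomial fun s a => ?_
  have h2 := mulOp_pow_monomial b i₀ (s.erase i₀) a (s i₀)
  rw [Finsupp.single_add_erase] at h2
  rw [Module.End.mul_apply, deformedOp_monomial, ← Module.End.mul_apply,
    mul_straightenPow he' hα' (polyRep_T_mul_mulOp b i (b i₁)) hq, Module.End.mul_apply, h2]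

variable (κ : ⋀[k]^2 V →ₗ[k] V × NilCoxeter k M d)

/-- In dimension two, if the generators are strictly triangular in the basis `b i₀, b i₁` and `κ`
has primitive values, then `H_{0,κ}` acts on `S(V) ⊗ A`: the generators of `A` act diagonally,
`b i₀` by multiplication, and `b i₁` by its deformed action. Letters `i₁` come last in sorted words,
where the deformed action is a multiplication, too. -/
lemma linearIndependent_pbwMonomial_of_triangular [LinearOrder ι] (h01 : i₀ < i₁)
    (hι : ∀ i, i = i₀ ∨ i = i₁) (he : ∀ i, T k M d i • b i₀ = 0)
    (hf : ∀ i, ∃ s : k, T k M d i • b i₁ = s • b i₀)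
    (hκV : ∀ x y i, T k M d i • kappaV κ (exteriorPower.ιMulti k 2 ![x, y]) = 0)
    (hκA : ∀ x y i, T k M d i • kappaA κ (exteriorPower.ιMulti k 2 ![x, y]) = 0)
    {J : Type (max u w)} (c : Module.Basis J k (NilCoxeter k M d)) :
    LinearIndependent k (pbwMonomial (coproduct k M d) 0 κ b c) := by
  classical
  obtain ⟨p, q, hpq⟩ : ∃ p q : k,
      kappaV κ (exteriorPower.ιMulti k 2 ![b i₀, b i₁]) = p • b i₀ + q • b i₁ := by
    have : Fintype ι := ⟨{i₀, i₁}, fun i => by simpa using hι i⟩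
    have hu : (Finset.univ : Finset ι) = {i₀, i₁} := by
      ext i
      simpa using hι i
    have hs := b.sum_repr (kappaV κ (exteriorPower.ιMulti k 2 ![b i₀, b i₁]))
    rw [hu, Finset.sum_pair h01.ne] at hs
    exact ⟨_, _, hs.symm⟩
  set α := kappaA κ (exteriorPower.ιMulti k 2 ![b i₀, b i₁]) with hα
  have hu : ∀ i, T k M d i • (p • b i₀ + q • b i₁) = 0 := fun i => hpq ▸ hκV _ _ i
  let φ : V →ₗ[k] Module.End k (MvPolynomial ι k ⊗[k] NilCoxeter k M d) :=
    b.constr k fun i => if i = i₀ then mulOp b (b i₀) else deformedOp b i₀ i₁ p q α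
  have hφ₀ : φ (b i₀) = mulOp b (b i₀) := by simp [φ]
  have hφ₁ : φ (b i₁) = deformedOp b i₀ i₁ p q α := by simp [φ, h01.ne']
  have hact : ∀ i j, polyRep b (T k M d i) * φ (b j) =
      φ (T k M d i • b j) * polyRep b (T k M d i) := by
    intro i j
    rcases hι j with rfl | rfl
    · rw [hφ₀, polyRep_T_mul_mulOp, he, map_zero, map_zero]
    · obtain ⟨s, hs⟩ := hf i
      rw [hφ₁, polyRep_T_mul_deformedOp i (he i) (hu i) (hα ▸ hκA _ _ i), hs, map_smul, map_smul,
        hφ₀]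
  have hcomm : φ (b i₀) * φ (b i₁) - φ (b i₁) * φ (b i₀) =
      φ (kappaV κ (exteriorPower.ιMulti k 2 ![b i₀, b i₁])) +
        polyRep b (kappaA κ (exteriorPower.ιMulti k 2 ![b i₀, b i₁])) := by
    rw [hpq, ← hα, map_add, map_smul, map_smul, hφ₀, hφ₁, deformedOp_mul_mulOp]
    abel
  let Φ := smashLiftOfBasis (R := Module.End k (MvPolynomial ι k ⊗[k] NilCoxeter k M d)) b hι κ
    (polyRep b) φ hact hcomm
  have hΦ : ∀ x, Φ (ofV _ 0 κ x) = φ x := fun x => lift_ofV _ _ _ _ _ _ _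
  refine linearIndependent_pbwMonomial_of_rep κ b c Φ (fun a => lift_ofA _ _ _ _ _ _ _)
    (fun i l hl a => ?_)
  rw [hΦ]
  rcases hι i with rfl | rfl
  · rw [hφ₀, mulOp_tmul, toPoly_basis]
  · -- In a sorted word, no letter `i₀` follows the letter `i₁`.
    have h0 : Multiset.toFinsupp (l : Multiset ι) i₀ = 0 := by
      rw [Multiset.toFinsupp_apply, Multiset.count_eq_zero, Multiset.mem_coe]
      exact fun hmem => (List.rel_of_pairwise_cons hl hmem).not_gt h01
    rw [hφ₁, deformedOp_monomial, h0,
      Finsupp.erase_of_notMem_support (Finsupp.notMem_support_iff.2 h0),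
      straightenPow, mulOp_tmul, toPoly_basis]

end Triangular

variable (κ : ⋀[k]^2 V →ₗ[k] V × NilCoxeter k M d)

lemma hasPBW_of_range_le_prim [Finite I] {n : ℕ} (hn : (maxIdeal k M d).asIdeal ^ n = ⊥)
    (hr : Module.rank k V ≤ 2) (hκV : LinearMap.range (kappaV κ) ≤ Prim k M d V)
    (hκA : LinearMap.range (kappaA κ) ≤ Prim k M d (NilCoxeter k M d)) :
    HasPBW (coproduct k M d) 0 κ := by
  have hfin : Module.Finite k V := Module.rank_lt_aleph0_iff.1
    (hr.trans_lt (Cardinal.natCast_lt_aleph0 (n := 2)))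
  have hle : Module.finrank k V ≤ 2 := Module.finrank_le_of_rank_le (by simpa using hr)
  rcases hle.lt_or_eq with hlt | h2
  · -- In dimension at most one there are no nonzero `κ`.
    refine hasPBW_of_eq_zero κ (exteriorPower.linearMap_ext (AlternatingMap.ext fun v => ?_))
    refine AlternatingMap.map_linearDependent _ _ fun hli => ?_
    have := hli.fintype_card_le_finrank
    simp at this
    omega
  intro ι _ J b c
  refine ⟨?_, span_pbwMonomial _ κ b c⟩
  have : Finite ι := Module.Finite.finite_basis b
  have := finite_of_maxIdeal_pow hn
  have : Finite J := Module.Finite.finite_basis c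
  have : Fintype ι := Fintype.ofFinite ι
  have hcard : Fintype.card ι = 2 := (Module.finrank_eq_card_basis b).symm.trans h2
  let σ : Fin 2 ≃o ι := Fintype.orderIsoFinOfCardEq ι hcard
  obtain ⟨B, hB0, hB1⟩ := exists_basis_triangular h2 hn
  refine linearIndependent_pbwMonomial_congr _ κ b (B.reindex σ.toEquiv) c ?_
  refine linearIndependent_pbwMonomial_of_triangular (i₀ := σ 0) (i₁ := σ 1) κ
    (σ.lt_iff_lt.2 (by decide)) (fun i => ?_) ?_ ?_
    (fun x y i => hκV ⟨_, rfl⟩ i) (fun x y i => hκA ⟨_, rfl⟩ i) c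
  · obtain ⟨j, rfl⟩ := σ.surjective i
    fin_cases j <;> simp
  · simpa using hB0
  · simpa using hB1

end

end NilCoxeter

/-! ### The PBW theorem -/

theorem theorem5 {k : Type u} [Field k] {I : Type w} [Finite I] (M : CoxeterMatrix I) (d : I → ℕ)
    (hd : ∀ i, 2 ≤ d i)
    (hnil : ∃ n : ℕ, (NilCoxeter.maxIdeal k M d).asIdeal ^ n = ⊥)
    {V : Type v} [AddCommGroup V] [Module k V] [Module (NilCoxeter k M d) V]
    [IsScalarTower k (NilCoxeter k M d) V]
    (κ : ⋀[k]^2 V →ₗ[k] V × NilCoxeter k M d) :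
    (Module.rank k V ≤ 2 →
      (DeformedSmash.HasPBW (NilCoxeter.coproduct k M d) 0 κ ↔
        LinearMap.range (DeformedSmash.kappaV κ) ≤ NilCoxeter.Prim k M d V ∧
        LinearMap.range (DeformedSmash.kappaA κ) ≤
          NilCoxeter.Prim k M d (NilCoxeter k M d))) ∧
    (Nonempty I → 2 < Module.rank k V → DeformedSmash.kappaV κ = 0 →
      (DeformedSmash.HasPBW (NilCoxeter.coproduct k M d) 0 κ ↔ DeformedSmash.kappaA κ = 0)) := by
  obtain ⟨n, hn⟩ := hnil
  refine ⟨fun hr => ⟨NilCoxeter.range_le_prim_of_hasPBW hd hr, fun h =>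
    NilCoxeter.hasPBW_of_range_le_prim κ hn hr h.1 h.2⟩, fun ⟨i⟩ hr hV => ⟨fun h =>
    NilCoxeter.kappaA_eq_zero_of_hasPBW hd hn h hV hr i, fun hA =>
    NilCoxeter.hasPBW_of_eq_zero κ (LinearMap.ext fun z => Prod.ext ?_ ?_)⟩⟩
  · exact LinearMap.congr_fun hV z
  · exact LinearMap.congr_fun hA z
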